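/- Let $a>0$ and $0<h<\frac12$. Let $\theta$ have the prior density $\mathrm{Beta}(\theta,a,a)\propto\theta^{a-1}(1-\theta)^{a-1}$ on $(0,1)$ and, given $\theta$, let $X_1,X_2,\dots$ be i.i.d. Bernoulli$(\theta)$; put $\mathscr F_t=\sigma(X_1,\dots,X_t)$ and $S_t=X_1+\dots+X_t$. For a cost $c>0$ and a horizon $H\in\{0,1,2,\dots\}$ consider the minimization of $c\,\mathsf E[T]+\mathsf P(|\hat\theta_T-\theta|>h)$ over all $(\mathscr F_t)$-stopping times $T\le H$ and all estimators $\hat\theta_t$ that are functions of $X_1,\dots,X_t$. Let $\mathscr C_t(s)=\inf_{m\in\mathbb R}\mathsf P(|m-\vartheta|>h)$ with $\vartheta\sim\mathrm{Beta}(a+s,a+t-s)$ (the posterior law of $\theta$ given $S_t=s$), and define $\mathscr V_H=\mathscr C_H$ and, for $t<H$, $$\mathscr V_t(s)=\min\Big\{\mathscr C_t(s),\;c+\tfrac{s+a}{t+2a}\mathscr V_{t+1}(s+1)+\big(1-\tfrac{s+a}{t+2a}\big)\mathscr V_{t+1}(s)\Big\}.$$ The optimum stopping time is $T_o=\inf\{0\le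 t\le H:\mathscr V_t(S_t)=\mathscr C_t(S_t)\}$. Write $n_a=\lceil a\rceil-1$, $\delta_a=a-n_a\in(0,1]$, and $$N=\Big\lceil\max\Big\{0,\tfrac{|\log c|+\log 2}{2h^2}-2a-1\Big\}\Big\rceil,$$ $$\nu=\Big\lfloor\max\Big\{0,\tfrac{|\log c|-\log\left((N+2n_a+\delta_a)^2\,\Gamma(\delta_a)\right)+\log\left(8(\frac14-h^2)^{\delta_a}\right)}{|\log(\frac12-h)|}-2n_a\Big\}\Big\rfloor .$$ Then: (0) For every $c>0$ and every $H$, $T_o$ is a stopping time that, together with a suitable estimator, attains the minimum above. (i) For every $c>0$ and every horizon $H$, $T_o\le N$; so $T_o$ never exceeds the deterministic bound $t_{\rm up}=N$, which does not depend on $H$. (ii) If $c>0$ satisfies $c(N+1)\le\mathscr C_0(0)$, then $\nu\le T_o$ for every horizon $H\ge N$. Moreover there is $c_0>0$, depending only on $a$ and $h$, such that every $c\in(0,c_0]$ satisfies $c(N+1)\le\mathscr C_0(0)$ and $\nu\ge1$; so for such $c$ and every $H\ge N$, $T_o\ge t_{\rm lo}$ with the deterministic time $t_{\rm lo}=\nu\ge1$.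 (iii) There are constants $0<C_0<C_1$ and $c_0>0$, depending only on $a$ and $h$, such that $T_o\le C_1|\log c|$ for every $c>0$ and every $H$, and $C_0|\log c|\le T_o$ for every $c\in(0,c_0]$ and every $H\ge N$. -/

import Mathlib

open MeasureTheory ProbabilityTheory

/-! Sequential fixed-width interval estimation of a Bernoulli parameter `θ` with symmetric
`Beta(a, a)` prior. The sample `X₁, X₂, …` is `X 0, X 1, …`; `true` is a success. -/

/-- `θ` has the `Beta(a, a)` law and, given `θ`, the `X i` are i.i.d. Bernoulli(`θ`): the joint law
of `θ` and of the first `t` observations is spelled out for every `t`. -/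
structure IsBetaBernoulli (a : ℝ) {Ω : Type*} [MeasurableSpace Ω] (μ : Measure Ω)
    (θ : Ω → ℝ) (X : ℕ → Ω → Bool) : Prop where
  measurable_param : Measurable θ
  measurable_obs : ∀ i, Measurable (X i)
  law : ∀ (t : ℕ) (x : ℕ → Bool) (B : Set ℝ), MeasurableSet B →
    μ {ω | θ ω ∈ B ∧ ∀ i < t, X i ω = x i} =
      ∫⁻ u in B, ∏ i ∈ Finset.range t, ENNReal.ofReal (if x i then u else 1 - u) ∂(betaMeasure a a)

/-- The filtration `ℱ_t = σ(X₁, …, X_t)`, with `ℱ_0` trivial. -/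
def obsFiltration {Ω : Type*} [m : MeasurableSpace Ω] (X : ℕ → Ω → Bool)
    (hX : ∀ i, Measurable (X i)) : Filtration ℕ m where
  seq t := ⨆ i : Fin t, MeasurableSpace.comap (X i) inferInstance
  mono' _ _ hst := iSup_le fun i =>
    le_iSup_of_le (Fin.castLE hst i) le_rfl
  le' _ := iSup_le fun i => (hX i).comap_le

/-- A sequential procedure with horizon `H`: a stopping time `T ≤ H` of the observations and, for
every `t`, a mid-point estimate `est t` that is a function of the first `t` observations. -/
structure IsProcedure {Ω : Type*} [MeasurableSpace Ω] (X : ℕ → Ω → Bool)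
    (hX : ∀ i, Measurable (X i)) (H : ℕ) (T : Ω → ℕ) (est : ℕ → Ω → ℝ) : Prop where
  stopping : IsStoppingTime (obsFiltration X hX) (fun ω => (T ω : WithTop ℕ))
  le_horizon : ∀ ω, T ω ≤ H
  measurable_est : ∀ t, Measurable[obsFiltration X hX t] (est t)

/-- The cost `c E[T] + P(|θ̂_T - θ| > h)`. -/
noncomputable def seqCost {Ω : Type*} [MeasurableSpace Ω] (μ : Measure Ω) (θ : Ω → ℝ)
    (h c : ℝ) (T : Ω → ℕ) (est : ℕ → Ω → ℝ) : ℝ :=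
  c * (∫ ω, (T ω : ℝ) ∂μ) + μ.real {ω | h < |est (T ω) ω - θ ω|}

/-- `(T, est)` minimizes the cost among all procedures with horizon `H`. -/
def IsOptimalProcedure {Ω : Type*} [MeasurableSpace Ω] (μ : Measure Ω) (θ : Ω → ℝ)
    (X : ℕ → Ω → Bool) (hX : ∀ i, Measurable (X i)) (h c : ℝ) (H : ℕ)
    (T : Ω → ℕ) (est : ℕ → Ω → ℝ) : Prop :=
  IsProcedure X hX H T est ∧
    ∀ (T' : Ω → ℕ) (est' : ℕ → Ω → ℝ), IsProcedure X hX H T' est' →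
      seqCost μ θ h c T est ≤ seqCost μ θ h c T' est'

/-- `𝒞_t(s)`: the smallest posterior probability of `|θ̂ - θ| > h` over all mid-points `θ̂`, after
`s` successes in `t` observations; the posterior is `Beta(a + s, a + t - s)`. -/
noncomputable def missProb (a h : ℝ) (t s : ℕ) : ℝ :=
  ⨅ m : ℝ, (betaMeasure (a + s) (a + t - s)).real {u | h < |m - u|}

/-- The predictive probability of a success after `s` successes in `t` observations. -/
noncomputable def predProb (a : ℝ) (t s : ℕ) : ℝ := (s + a) / (t + 2 * a)

/-- The optimal residual cost at time `t` with `s` successes when at most `k` more observations may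
be taken (backward recursion `𝒱_t = min {𝒞_t, c + E[𝒱_{t+1} | ℱ_t]}`, started from `𝒞` at the
horizon). -/
noncomputable def residualCost (a h c : ℝ) : ℕ → ℕ → ℕ → ℝ
  | 0, t, s => missProb a h t s
  | k + 1, t, s => min (missProb a h t s)
      (c + (predProb a t s * residualCost a h c k (t + 1) (s + 1)
        + (1 - predProb a t s) * residualCost a h c k (t + 1) s))

/-- `S_t`, the number of successes among the first `t` terms of a binary sequence. -/
def successes (x : ℕ → Bool) (t : ℕ) : ℕ := ∑ i ∈ Finset.range t, (x i).toNat

/-- The optimum stopping time `T_o = inf {0 ≤ t ≤ H : 𝒱_t(S_t) = 𝒞_t(S_t)}` for horizon `H`, as a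
function of the sequence of observations. The set always contains `H`. -/
noncomputable def optTime (a h c : ℝ) (H : ℕ) (x : ℕ → Bool) : ℕ :=
  sInf {t | t ≤ H ∧
    residualCost a h c (H - t) t (successes x t) = missProb a h t (successes x t)}

/-- `n_a`: the integer part of `a` if `a` is not an integer, and `a - 1` if it is. -/
noncomputable def intPart (a : ℝ) : ℝ := (⌈a⌉ : ℝ) - 1

/-- `δ_a = a - n_a ∈ (0, 1]`. -/
noncomputable def fracPart (a : ℝ) : ℝ := a - intPart a

/-- The explicit upper bound `N`. -/
noncomputable def upperTime (a h c : ℝ) : ℕ :=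
  ⌈max 0 ((|Real.log c| + Real.log 2) / (2 * h ^ 2) - 2 * a - 1)⌉₊

/-- The explicit lower bound `ν`. -/
noncomputable def lowerTime (a h c : ℝ) : ℕ :=
  ⌊max 0 ((|Real.log c|
        - Real.log ((upperTime a h c + 2 * intPart a + fracPart a) ^ 2 * Real.Gamma (fracPart a))
        + Real.log (8 * (1 / 4 - h ^ 2) ^ fracPart a)) / |Real.log (1 / 2 - h)|
      - 2 * intPart a)⌋₊

/-! ### Beta laws: Stein identity, reflection, tail bounds from below. -/

section BetaMeasure

open Set

variable {α β : ℝ}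

/-! Upper bound. One more observation costs `c`, so sampling stops once the posterior miss
probability is at most `c`. A Beta law is sub-Gaussian with variance proxy `1 / (4 (α + β + 1))`, so
after `t` observations the miss probability is below `2 exp (-2 h² (t + 2a + 1))` whatever the data
(`missProb_lt`); `N` is the first integer at which this is at most `c` when `c ≤ 1`.

Lower bound. An interval of half-width `h` leaves out one of the tails `(0, 1/2 - h)`, `(1/2 + h,
1)`, so the miss probability is at least geometric in `t` with ratio `1/2 - h`, up to a linear
factor, uniformly in the data (`geometric_le_missProb`). On the other hand, sampling up to `N` and
then stopping has residual cost below `c (N - t + 1)` (`residualCost_lt`). Stopping is therefore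
suboptimal while the geometric bound exceeds this cost; `ν` is a time before which it does, except
at time `0`, which the condition `c (N + 1) ≤ 𝒞_0` handles. As `N = O(|log c|)` and `log N = o(|log
c|)`, `ν` has order `|log c|`.

Optimality is backward induction along the tree of observed sequences: by conjugacy, the cost
carried by a cylinder is its probability times a function of `(t, s)`, bounded below by
`residualCost` for every procedure (`residualCost_le_costOn`) and attained by `optTime`
(`costOn_optTime_le`). -/

theorem ae_mem_Ioo_betaMeasure (α β : ℝ) : ∀ᵐ u ∂betaMeasure α β, u ∈ Ioo (0 : ℝ) 1 := by
  rw [betaMeasure, ae_withDensity_iff (by unfold betaPDF; fun_prop)]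
  refine Filter.Eventually.of_forall fun u hu => ?_
  by_contra hcon
  apply hu
  rw [betaPDF_eq, if_neg (show ¬(0 < u ∧ u < 1) from hcon), ENNReal.ofReal_zero]

theorem betaPDFReal_nonneg (hα : 0 < α) (hβ : 0 < β) (u : ℝ) : 0 ≤ betaPDFReal α β u := by
  by_cases hu : 0 < u ∧ u < 1
  · exact (betaPDFReal_pos hu.1 hu.2 hα hβ).le
  · rw [betaPDFReal, if_neg hu]

theorem integral_betaMeasure (hα : 0 < α) (hβ : 0 < β) (g : ℝ → ℝ) :
    ∫ u, g u ∂betaMeasure α β = ∫ u, betaPDFReal α β u * g u := by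
  rw [betaMeasure, integral_withDensity_eq_integral_toReal_smul (by unfold betaPDF; fun_prop)
    (by simp [betaPDF])]
  refine integral_congr_ae (Filter.Eventually.of_forall fun u => ?_)
  simp [betaPDF, ENNReal.toReal_ofReal (betaPDFReal_nonneg hα hβ u)]

theorem integrable_betaMeasure_iff (hα : 0 < α) (hβ : 0 < β) (g : ℝ → ℝ) :
    Integrable g (betaMeasure α β) ↔ Integrable (fun u => betaPDFReal α β u * g u) := by
  rw [betaMeasure, integrable_withDensity_iff (by unfold betaPDF; fun_prop) (by simp [betaPDF])]
  refine integrable_congr (Filter.Eventually.of_forall fun u => ?_)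
  simp [betaPDF, ENNReal.toReal_ofReal (betaPDFReal_nonneg hα hβ u), mul_comm]

theorem integrable_betaMeasure_of_continuous (hα : 0 < α) (hβ : 0 < β) {g : ℝ → ℝ}
    (hg : Continuous g) : Integrable g (betaMeasure α β) := by
  have := isProbabilityMeasureBeta hα hβ
  obtain ⟨C, hC⟩ := (isCompact_Icc (a := (0 : ℝ)) (b := 1)).exists_bound_of_continuousOn
    hg.continuousOn
  refine Integrable.of_bound hg.aestronglyMeasurable C ?_
  filter_upwards [ae_mem_Ioo_betaMeasure α β] with u hu
  exact hC u (Ioo_subset_Icc_self hu)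

/-- The integrand against Lebesgue measure is the derivative of `u ^ α (1 - u) ^ β exp (l u) / beta
α β`, which vanishes at both ends of `[0, 1]`. -/
theorem integral_stein_betaMeasure (hα : 0 < α) (hβ : 0 < β) (l : ℝ) :
    ∫ u, (α - (α + β) * u + l * (u * (1 - u))) * Real.exp (l * u) ∂betaMeasure α β = 0 := by
  set g : ℝ → ℝ := fun u => (α - (α + β) * u + l * (u * (1 - u))) * Real.exp (l * u) with hg
  have hgc : Continuous g := by fun_prop
  have hint := (integrable_betaMeasure_iff hα hβ g).1 (integrable_betaMeasure_of_continuous hα hβ hgc)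
  rw [integral_betaMeasure hα hβ]
  have hzero : ∀ u ∉ Ioc (0 : ℝ) 1, betaPDFReal α β u * g u = 0 := by
    intro u hu
    rw [betaPDFReal, if_neg (fun h => hu ⟨h.1, h.2.le⟩), zero_mul]
  rw [← setIntegral_eq_integral_of_forall_compl_eq_zero hzero,
    ← intervalIntegral.integral_of_le zero_le_one]
  set F : ℝ → ℝ := fun u => 1 / beta α β * (u ^ α * (1 - u) ^ β * Real.exp (l * u)) with hF
  rw [intervalIntegral.integral_eq_sub_of_hasDerivAt_of_le (f := F) zero_le_one]
  · simp [hF, Real.zero_rpow hα.ne', Real.zero_rpow hβ.ne']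
  · refine Continuous.continuousOn ?_
    have h1 : Continuous fun u : ℝ => u ^ α := Real.continuous_rpow_const hα.le
    have h2 : Continuous fun u : ℝ => (1 - u) ^ β :=
      (Real.continuous_rpow_const hβ.le).comp (by fun_prop)
    fun_prop
  · intro u hu
    have hu0 : u ≠ 0 := hu.1.ne'
    have hu1 : 1 - u ≠ 0 := (sub_pos.2 hu.2).ne'
    have d1 : HasDerivAt (fun u : ℝ => u ^ α) (α * u ^ (α - 1)) u := by
      simpa using Real.hasDerivAt_rpow_const (p := α) (Or.inl hu0)
    have d2 : HasDerivAt (fun u : ℝ => (1 - u) ^ β) (β * (1 - u) ^ (β - 1) * (-1)) u := by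
      have d0 : HasDerivAt (fun u : ℝ => 1 - u) (-1) u := by
        simpa using (hasDerivAt_id u).const_sub 1
      exact (Real.hasDerivAt_rpow_const (p := β) (Or.inl hu1)).comp u d0
    have d3 : HasDerivAt (fun u : ℝ => Real.exp (l * u)) (Real.exp (l * u) * (l * 1)) u :=
      ((hasDerivAt_id u).const_mul l).exp
    have d := ((d1.mul d2).mul d3).const_mul (1 / beta α β)
    refine d.congr_deriv ?_
    have e1 : u ^ α = u ^ (α - 1) * u := by
      rw [← Real.rpow_add_one hu0]; simp
    have e2 : (1 - u) ^ β = (1 - u) ^ (β - 1) * (1 - u) := by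
      rw [← Real.rpow_add_one hu1]; simp
    simp only [hg, betaPDFReal, if_pos (show 0 < u ∧ u < 1 from hu), Pi.mul_apply, e1, e2]
    ring
  · rw [intervalIntegrable_iff_integrableOn_Ioc_of_le zero_le_one]
    exact hint.integrableOn

theorem map_one_sub_betaMeasure (α β : ℝ) :
    (betaMeasure α β).map (fun u => 1 - u) = betaMeasure β α := by
  have hm : Measurable fun u : ℝ => 1 - u := by fun_prop
  ext s hs
  have hpdf : ∀ u, betaPDF α β u = betaPDF β α (1 - u) := by
    intro u
    rw [betaPDF_eq, betaPDF_eq]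
    congr 1
    have : beta α β = beta β α := by unfold beta; rw [mul_comm, add_comm]
    rw [this, sub_sub_cancel]
    by_cases h : 0 < u ∧ u < 1
    · rw [if_pos h, if_pos ⟨by linarith [h.2], by linarith [h.1]⟩]
      ring
    · rw [if_neg h, if_neg fun h' => h ⟨by linarith [h'.2], by linarith [h'.1]⟩]
  rw [Measure.map_apply hm hs, betaMeasure, betaMeasure, withDensity_apply _ (hm hs),
    withDensity_apply _ hs]
  simp_rw [hpdf]
  have hmp : MeasurePreserving (fun u : ℝ => 1 - u) volume volume :=
    Measure.measurePreserving_sub_left volume 1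
  exact hmp.setLIntegral_comp_preimage hs (by unfold betaPDF; fun_prop)

theorem betaMeasure_real_Ioo_one_sub (hα : 0 < α) (hβ : 0 < β) {q : ℝ} (hq : 0 < q)
    (hq1 : q < 1) :
    (1 - q) ^ α * q ^ β / (β * beta α β) ≤ (betaMeasure α β).real (Ioo (1 - q) 1) := by
  have := isProbabilityMeasureBeta hα hβ
  have hB := beta_pos hα hβ
  have hint : Integrable (betaPDFReal α β) := by
    simpa using (integrable_betaMeasure_iff hα hβ fun _ => 1).1 (integrable_const 1)
  have heq : (betaMeasure α β).real (Ioo (1 - q) 1) = ∫ u in Ioc (1 - q) 1, betaPDFReal α β u := by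
    rw [integral_Ioc_eq_integral_Ioo, ← integral_indicator_one measurableSet_Ioo,
      integral_betaMeasure hα hβ, ← integral_indicator measurableSet_Ioo]
    congr 1
    ext u
    by_cases hu : u ∈ Ioo (1 - q) 1 <;> simp [hu]
  have hii : IntervalIntegrable (fun u : ℝ => (1 - u) ^ (β - 1)) volume (1 - q) 1 := by
    have := (intervalIntegral.intervalIntegrable_rpow' (a := q) (b := 0) (r := β - 1)
      (by linarith)).comp_sub_left 1
    simpa using this
  have hval : ∫ u in (1 - q)..1, (1 - u) ^ (β - 1) = q ^ β / β := by
    rw [intervalIntegral.integral_comp_sub_left (fun u => u ^ (β - 1)) 1]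
    rw [integral_rpow (Or.inl (by linarith))]
    simp [Real.zero_rpow hβ.ne']
  have hlow : (1 - q) ^ α * q ^ β / (β * beta α β) =
      ∫ u in Ioc (1 - q) 1, (1 - q) ^ α / beta α β * (1 - u) ^ (β - 1) := by
    rw [← intervalIntegral.integral_of_le (by linarith), intervalIntegral.integral_const_mul, hval]
    field_simp
  rw [heq, hlow, integral_Ioc_eq_integral_Ioo, integral_Ioc_eq_integral_Ioo]
  refine setIntegral_mono_on ?_ hint.integrableOn measurableSet_Ioo ?_
  · rw [intervalIntegrable_iff_integrableOn_Ioo_of_le (by linarith)] at hii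
    exact hii.const_mul _
  · intro u hu
    have hu0 : 0 < u := by linarith [hu.1]
    rw [betaPDFReal, if_pos ⟨hu0, hu.2⟩]
    -- Using exponent `α` on the left instead of `α - 1` covers `α < 1` too, where `u ^ (α - 1)` is
    -- decreasing.
    have h1 : (1 - q) ^ α ≤ u ^ (α - 1) := by
      rw [Real.rpow_sub_one hu0.ne', le_div_iff₀ hu0]
      calc (1 - q) ^ α * u ≤ (1 - q) ^ α * 1 := by
            exact mul_le_mul_of_nonneg_left hu.2.le (Real.rpow_nonneg (by linarith) _)
        _ = (1 - q) ^ α := mul_one _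
        _ ≤ u ^ α := Real.rpow_le_rpow (by linarith) hu.1.le hα.le
    have h2 : 0 ≤ (1 - u) ^ (β - 1) := Real.rpow_nonneg (by linarith [hu.2]) _
    rw [div_eq_mul_one_div, mul_comm _ (1 / beta α β)]
    gcongr

theorem betaMeasure_real_Ioo_zero (hα : 0 < α) (hβ : 0 < β) {q : ℝ} (hq : 0 < q)
    (hq1 : q < 1) :
    q ^ α * (1 - q) ^ β / (α * beta α β) ≤ (betaMeasure α β).real (Ioo 0 q) := by
  have h := betaMeasure_real_Ioo_one_sub hβ hα hq hq1
  rw [← map_one_sub_betaMeasure α β, map_measureReal_apply (by fun_prop) measurableSet_Ioo] at h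
  have hB : beta β α = beta α β := by unfold beta; rw [mul_comm, add_comm]
  have hs : (fun u : ℝ => 1 - u) ⁻¹' Ioo (1 - q) 1 = Ioo 0 q := by
    ext u; simp [and_comm]
  rw [hs, hB, mul_comm ((1 - q) ^ β)] at h
  exact h

end BetaMeasure

/-! ### Sub-Gaussian concentration of the Beta law. -/

section SubGaussian

open Set

variable {α β : ℝ}

theorem hasDerivAt_integral_pow_mul_exp_betaMeasure (hα : 0 < α) (hβ : 0 < β) (n : ℕ) (l : ℝ) :
    HasDerivAt (fun l => ∫ u, u ^ n * Real.exp (l * u) ∂betaMeasure α β)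
      (∫ u, u ^ (n + 1) * Real.exp (l * u) ∂betaMeasure α β) l := by
  refine hasDerivAt_integral_pow_mul_exp_real (X := fun u : ℝ => u) ?_ n
  have : integrableExpSet (fun u : ℝ => u) (betaMeasure α β) = univ := by
    ext l
    simp only [integrableExpSet, mem_ofPred_eq, mem_univ, iff_true]
    exact integrable_betaMeasure_of_continuous hα hβ (by fun_prop)
  simp [this]

/-- The logarithmic derivative of the moment generating function of `Beta(α, β)` exceeds the mean
by at most `l / (4 (α + β + 1))`: by Stein's identity it solves a Riccati equation. -/
theorem tilted_mean_betaMeasure_le (hα : 0 < α) (hβ : 0 < β) {l : ℝ} (hl : 0 < l) :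
    (∫ u, u * Real.exp (l * u) ∂betaMeasure α β) / (∫ u, Real.exp (l * u) ∂betaMeasure α β)
      ≤ α / (α + β) + l / (4 * (α + β + 1)) := by
  have := isProbabilityMeasureBeta hα hβ
  set n := α + β with hn
  have hnpos : 0 < n := add_pos hα hβ
  set M : ℕ → ℝ → ℝ := fun k l => ∫ u, u ^ k * Real.exp (l * u) ∂betaMeasure α β with hM
  have hMd : ∀ k l, HasDerivAt (M k) (M (k + 1) l) l := fun k l =>
    hasDerivAt_integral_pow_mul_exp_betaMeasure hα hβ k l
  have hint : ∀ k l, Integrable (fun u => u ^ k * Real.exp (l * u)) (betaMeasure α β) := fun k l =>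
    integrable_betaMeasure_of_continuous hα hβ (by fun_prop)
  have hM0 : ∀ l, 0 < M 0 l := by
    intro l
    have hp := integral_exp_pos (μ := betaMeasure α β) (f := fun u => l * u)
      (integrable_betaMeasure_of_continuous hα hβ (by fun_prop))
    simpa [hM] using hp
  have hode : ∀ l, α * M 0 l - n * M 1 l + l * (M 1 l - M 2 l) = 0 := by
    intro l
    rw [← integral_stein_betaMeasure hα hβ l]
    simp only [hM]
    have i1 : Integrable (fun u => α * (u ^ 0 * Real.exp (l * u)) - n * (u ^ 1 * Real.exp (l * u)))
        (betaMeasure α β) := ((hint 0 l).const_mul _).sub ((hint 1 l).const_mul _)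
    have i2 : Integrable (fun u => l * (u ^ 1 * Real.exp (l * u) - u ^ 2 * Real.exp (l * u)))
        (betaMeasure α β) := ((hint 1 l).sub (hint 2 l)).const_mul _
    rw [← integral_sub (hint 1 l) (hint 2 l), ← integral_const_mul, ← integral_const_mul,
      ← integral_const_mul, ← integral_sub ((hint 0 l).const_mul _) ((hint 1 l).const_mul _),
      ← integral_add i1 i2]
    refine integral_congr_ae (Filter.Eventually.of_forall fun u => ?_)
    simp only [hn]
    ring
  set ψ : ℝ → ℝ := fun l => M 1 l / M 0 l with hψ
  have hψd : ∀ l, HasDerivAt ψ ((M 2 l * M 0 l - M 1 l * M 1 l) / M 0 l ^ 2) l := fun l =>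
    (hMd 1 l).div (hMd 0 l) (hM0 l).ne'
  have hψc : Continuous ψ := continuous_iff_continuousAt.2 fun l => (hψd l).continuousAt
  -- The Riccati equation is `l ψ' + n ψ = α + l ψ (1 - ψ)`, with integrating factor `l ^ (n - 1)`.
  -- Replacing `ψ (1 - ψ)` by its maximum `1/4` gives the comparison solution `α / n + l / (4 (n +
  -- 1))`.
  set G : ℝ → ℝ := fun l => l ^ n * (ψ l - α / n - l / (4 * (n + 1))) with hG
  have hanti : AntitoneOn G (Ici 0) := by
    refine antitoneOn_of_deriv_nonpos (convex_Ici 0) ?_ ?_ ?_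
    · have : Continuous fun l : ℝ => l ^ n := Real.continuous_rpow_const hnpos.le
      exact Continuous.continuousOn (by fun_prop)
    all_goals
      intro l hl
      rw [interior_Ici] at hl
      have hl0 : l ≠ 0 := (mem_Ioi.1 hl).ne'
      have hd : HasDerivAt G _ l := (Real.hasDerivAt_rpow_const (p := n) (Or.inl hl0)).mul
        (((hψd l).sub_const (α / n)).sub ((hasDerivAt_id l).div_const (4 * (n + 1))))
    · exact hd.differentiableAt.differentiableWithinAt
    · rw [hd.deriv]
      have hpow : l ^ n = l ^ (n - 1) * l := by rw [← Real.rpow_add_one hl0]; simp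
      have hval : n * l ^ (n - 1) * (ψ l - α / n - l / (4 * (n + 1))) +
          l ^ n * ((M 2 l * M 0 l - M 1 l * M 1 l) / M 0 l ^ 2 - 1 / (4 * (n + 1))) =
          l ^ (n - 1) * (l * (ψ l * (1 - ψ l) - 1 / 4)) := by
        have h0 := (hM0 l).ne'
        have hM2 : l * M 2 l = α * M 0 l - n * M 1 l + l * M 1 l := by linarith [hode l]
        have key : l * ((M 2 l * M 0 l - M 1 l * M 1 l) / M 0 l ^ 2) =
            α - n * ψ l + l * ψ l * (1 - ψ l) := by
          simp only [hψ]
          field_simp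
          linear_combination M 0 l * hM2
        rw [hpow, mul_assoc _ l, mul_sub l, key]
        field_simp
        ring
      rw [show _ = _ from hval]
      refine mul_nonpos_of_nonneg_of_nonpos (Real.rpow_nonneg (le_of_lt hl) _)
        (mul_nonpos_of_nonneg_of_nonpos (le_of_lt hl) ?_)
      nlinarith [sq_nonneg (ψ l - 1 / 2)]
  have hle := hanti (mem_Ici.2 le_rfl) (mem_Ici.2 hl.le) hl.le
  have hG0 : G 0 = 0 := by simp [hG, Real.zero_rpow hnpos.ne']
  rw [hG0] at hle
  have hfin : ψ l - α / n - l / (4 * (n + 1)) ≤ 0 := by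
    by_contra hcon
    exact absurd hle (not_le.2 (mul_pos (Real.rpow_pos_of_pos hl n) (not_le.1 hcon)))
  have : ψ l ≤ α / n + l / (4 * (n + 1)) := by linarith
  simpa [hψ, hM] using this

/-- Integrates the bound on the logarithmic derivative from `0` to `l`. -/
theorem integral_exp_betaMeasure_le_of_nonneg (hα : 0 < α) (hβ : 0 < β) {l : ℝ} (hl : 0 ≤ l) :
    ∫ u, Real.exp (l * u) ∂betaMeasure α β ≤
      Real.exp (α / (α + β) * l + l ^ 2 / (8 * (α + β + 1))) := by
  have := isProbabilityMeasureBeta hα hβ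
  have hnpos : 0 < α + β := add_pos hα hβ
  set Y : ℝ → ℝ := fun l => ∫ u, Real.exp (l * u) ∂betaMeasure α β with hY
  have hYd : ∀ l, HasDerivAt Y (∫ u, u * Real.exp (l * u) ∂betaMeasure α β) l := by
    intro l
    simpa using hasDerivAt_integral_pow_mul_exp_betaMeasure hα hβ 0 l
  have hY0 : ∀ l, 0 < Y l := fun l => integral_exp_pos (f := fun u => l * u)
    (integrable_betaMeasure_of_continuous hα hβ (by fun_prop))
  set K : ℝ → ℝ := fun l => Real.log (Y l) - (α / (α + β) * l + l ^ 2 / (8 * (α + β + 1))) with hK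
  have hKd : ∀ l, HasDerivAt K ((∫ u, u * Real.exp (l * u) ∂betaMeasure α β) / Y l -
      (α / (α + β) + l / (4 * (α + β + 1)))) l := by
    intro l
    have d2 : HasDerivAt (fun l : ℝ => α / (α + β) * l + l ^ 2 / (8 * (α + β + 1)))
        (α / (α + β) * 1 + (2 * l) / (8 * (α + β + 1))) l := by
      exact ((hasDerivAt_id l).const_mul (α / (α + β))).add
        (((hasDerivAt_pow 2 l).congr_deriv (by norm_num)).div_const (8 * (α + β + 1)))
    refine (((hYd l).log (hY0 l).ne').sub d2).congr_deriv ?_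
    congr 1
    field_simp
    ring
  have hanti : AntitoneOn K (Ici 0) := by
    refine antitoneOn_of_deriv_nonpos (convex_Ici 0)
      (fun l _ => (hKd l).continuousAt.continuousWithinAt)
      (fun l _ => (hKd l).differentiableAt.differentiableWithinAt) fun l hl => ?_
    rw [interior_Ici] at hl
    rw [(hKd l).deriv]
    linarith [tilted_mean_betaMeasure_le hα hβ (mem_Ioi.1 hl)]
  have hle := hanti (mem_Ici.2 le_rfl) (mem_Ici.2 hl) hl
  have hK0 : K 0 = 0 := by simp [hK, hY]
  rw [hK0] at hle
  rw [← Real.log_le_iff_le_exp (hY0 l)]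
  simp only [hK] at hle
  linarith

/-- The Beta distribution is sub-Gaussian with variance proxy `1 / (4 (α + β + 1))`. -/
theorem integral_exp_sub_mean_betaMeasure_le (hα : 0 < α) (hβ : 0 < β) (l : ℝ) :
    ∫ u, Real.exp (l * (u - α / (α + β))) ∂betaMeasure α β ≤
      Real.exp (l ^ 2 / (8 * (α + β + 1))) := by
  have hnpos : 0 < α + β := add_pos hα hβ
  rcases le_total 0 l with hl | hl
  · have h := integral_exp_betaMeasure_le_of_nonneg hα hβ hl
    have he : ∀ u : ℝ, Real.exp (l * (u - α / (α + β))) =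
        Real.exp (-(α / (α + β) * l)) * Real.exp (l * u) := by
      intro u; rw [← Real.exp_add]; congr 1; ring
    simp_rw [he]
    rw [integral_const_mul]
    refine (mul_le_mul_of_nonneg_left h (Real.exp_pos _).le).trans_eq ?_
    rw [← Real.exp_add]; congr 1; ring
  · have h := integral_exp_betaMeasure_le_of_nonneg hβ hα (neg_nonneg.2 hl)
    rw [← map_one_sub_betaMeasure β α, integral_map (by fun_prop)
      (Continuous.aestronglyMeasurable (by fun_prop))]
    have he : ∀ u : ℝ, Real.exp (l * (1 - u - α / (α + β))) =
        Real.exp (-(β / (α + β) * -l)) * Real.exp (-l * u) := by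
      intro u; rw [← Real.exp_add]; congr 1
      field_simp
      ring
    simp_rw [he]
    rw [integral_const_mul]
    refine (mul_le_mul_of_nonneg_left h (Real.exp_pos _).le).trans_eq ?_
    rw [← Real.exp_add, add_comm β α]; congr 1; ring

/-- Markov's inequality for `cosh` treats both tails at once, and `exp x / 2 < cosh x` makes the
result strict. Strictness is needed later, where equality is allowed in `c (N + 1) ≤ 𝒞_0`. -/
theorem betaMeasure_real_deviation_lt (hα : 0 < α) (hβ : 0 < β) {h : ℝ} (hh : 0 < h) :
    (betaMeasure α β).real {u | h < |α / (α + β) - u|} <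
      2 * Real.exp (-(2 * h ^ 2 * (α + β + 1))) := by
  have := isProbabilityMeasureBeta hα hβ
  have hnpos : 0 < α + β := add_pos hα hβ
  set μ₀ := α / (α + β)
  -- Minimizer of the Chernoff exponent `l² / (8 (α + β + 1)) - l h`.
  set l := 4 * (α + β + 1) * h with hl
  have hlpos : 0 < l := by positivity
  have hi : ∀ r : ℝ, Integrable (fun u => Real.exp (r * (u - μ₀))) (betaMeasure α β) := fun r =>
    integrable_betaMeasure_of_continuous hα hβ (by fun_prop)
  have hcosh : ∫ u, Real.cosh (l * (u - μ₀)) ∂betaMeasure α β ≤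
      Real.exp (l ^ 2 / (8 * (α + β + 1))) := by
    have he : ∀ u, Real.cosh (l * (u - μ₀)) =
        (Real.exp (l * (u - μ₀)) + Real.exp (-l * (u - μ₀))) / 2 := by
      intro u; rw [Real.cosh_eq, neg_mul]
    simp_rw [he]
    rw [integral_div, integral_add (hi l) (hi (-l))]
    have h1 := integral_exp_sub_mean_betaMeasure_le hα hβ l
    have h2 := integral_exp_sub_mean_betaMeasure_le hα hβ (-l)
    rw [neg_sq] at h2
    linarith
  have hmarkov := mul_meas_ge_le_integral_of_nonneg (μ := betaMeasure α β)
    (f := fun u => Real.cosh (l * (u - μ₀)))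
    (Filter.Eventually.of_forall fun u => (Real.cosh_pos _).le)
    (integrable_betaMeasure_of_continuous hα hβ (by fun_prop)) (Real.cosh (l * h))
  have hsub : (betaMeasure α β).real {u | h < |μ₀ - u|} ≤
      (betaMeasure α β).real {u | Real.cosh (l * h) ≤ Real.cosh (l * (u - μ₀))} := by
    refine measureReal_mono fun u hu => ?_
    simp only [mem_ofPred_eq] at hu ⊢
    rw [Real.cosh_le_cosh, abs_of_pos (mul_pos hlpos hh), abs_mul, abs_of_pos hlpos]
    rw [abs_sub_comm] at hu
    exact mul_le_mul_of_nonneg_left hu.le hlpos.le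
  have hc : Real.exp (l * h) / 2 < Real.cosh (l * h) := by
    rw [Real.cosh_eq]
    linarith [Real.exp_pos (-(l * h))]
  have hcp := Real.cosh_pos (l * h)
  set P := (betaMeasure α β).real {u | h < |μ₀ - u|}
  have hP : Real.cosh (l * h) * P ≤ Real.exp (l ^ 2 / (8 * (α + β + 1))) :=
    (mul_le_mul_of_nonneg_left hsub hcp.le).trans (hmarkov.trans hcosh)
  by_contra hcon
  push Not at hcon
  have h3 : Real.exp (l * h) / 2 * (2 * Real.exp (-(2 * h ^ 2 * (α + β + 1)))) =
      Real.exp (l ^ 2 / (8 * (α + β + 1))) := by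
    rw [show Real.exp (l * h) / 2 * (2 * Real.exp (-(2 * h ^ 2 * (α + β + 1)))) =
      Real.exp (l * h) * Real.exp (-(2 * h ^ 2 * (α + β + 1))) by ring, ← Real.exp_add]
    congr 1
    simp only [hl]
    field_simp
    ring
  have h4 : Real.exp (l * h) / 2 * (2 * Real.exp (-(2 * h ^ 2 * (α + β + 1)))) <
      Real.cosh (l * h) * P :=
    mul_lt_mul hc hcon (by positivity) hcp.le
  linarith

end SubGaussian

/-! ### Bounds on the posterior miss probability. -/

section MissProb

open Set

variable {a h : ℝ} {t s : ℕ}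

theorem missProb_nonneg (a h : ℝ) (t s : ℕ) : 0 ≤ missProb a h t s :=
  Real.iInf_nonneg fun _ => measureReal_nonneg

theorem missProb_le (a h : ℝ) (t s : ℕ) (m : ℝ) :
    missProb a h t s ≤ (betaMeasure (a + s) (a + t - s)).real {u | h < |m - u|} :=
  ciInf_le ⟨0, by rintro _ ⟨m, rfl⟩; exact measureReal_nonneg⟩ m

theorem posterior_param_pos (ha : 0 < a) (hs : s ≤ t) : 0 < a + s ∧ 0 < a + t - s := by
  have : (s : ℝ) ≤ t := by exact_mod_cast hs
  constructor <;> [positivity; linarith]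

theorem missProb_lt (ha : 0 < a) (hh : 0 < h) (hs : s ≤ t) :
    missProb a h t s < 2 * Real.exp (-(2 * h ^ 2 * (t + 2 * a + 1))) := by
  obtain ⟨hα, hβ⟩ := posterior_param_pos ha hs
  refine (missProb_le a h t s _).trans_lt
    ((betaMeasure_real_deviation_lt hα hβ hh).trans_eq ?_)
  congr 4
  ring

theorem missProb_le_one (ha : 0 < a) (hs : s ≤ t) : missProb a h t s ≤ 1 := by
  obtain ⟨hα, hβ⟩ := posterior_param_pos ha hs
  have := isProbabilityMeasureBeta hα hβ
  exact (missProb_le a h t s 0).trans measureReal_le_one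

/-- An interval centred at `m ≤ 1/2` misses the right tail `(1/2 + h, 1)`, and one centred at `m ≥
1/2` misses the left tail `(0, 1/2 - h)`. -/
theorem le_missProb (ha : 0 < a) (hh : 0 < h) (hh' : h < 1 / 2) (hs : s ≤ t) {b : ℝ}
    (h1 : b ≤ (1 / 2 + h) ^ (a + s) * (1 / 2 - h) ^ (a + t - s) /
      ((a + t - s) * beta (a + s) (a + t - s)))
    (h2 : b ≤ (1 / 2 - h) ^ (a + s) * (1 / 2 + h) ^ (a + t - s) /
      ((a + s) * beta (a + s) (a + t - s))) : b ≤ missProb a h t s := by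
  obtain ⟨hα, hβ⟩ := posterior_param_pos ha hs
  have := isProbabilityMeasureBeta hα hβ
  have hq : 1 - (1 / 2 - h) = 1 / 2 + h := by ring
  refine le_ciInf fun m => ?_
  rcases le_total m (1 / 2) with hm | hm
  · refine (h1.trans ?_).trans (measureReal_mono (s₁ := Ioo (1 - (1 / 2 - h)) 1) fun u hu => ?_)
    · have := betaMeasure_real_Ioo_one_sub hα hβ (q := 1 / 2 - h) (by linarith) (by linarith)
      rwa [hq] at this ⊢
    · have := hu.1
      rw [mem_ofPred_eq, lt_abs]
      right; linarith
  · refine (h2.trans ?_).trans (measureReal_mono (s₁ := Ioo 0 (1 / 2 - h)) fun u hu => ?_)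
    · have := betaMeasure_real_Ioo_zero hα hβ (q := 1 / 2 - h) (by linarith) (by linarith)
      rwa [hq] at this
    · have := hu.2
      rw [mem_ofPred_eq, lt_abs]
      left; linarith

theorem missProb_pos (ha : 0 < a) (hh : 0 < h) (hh' : h < 1 / 2) (hs : s ≤ t) :
    0 < missProb a h t s := by
  obtain ⟨hα, hβ⟩ := posterior_param_pos ha hs
  have hB := beta_pos hα hβ
  have hq : 0 < 1 / 2 - h := by linarith
  exact (lt_min (by positivity) (by positivity)).trans_le
    (le_missProb ha hh hh' hs (min_le_left _ _) (min_le_right _ _))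

/-- Already the mid-point `0` covers `(0, h)`, which has positive mass. -/
theorem missProb_zero_lt_one (ha : 0 < a) (hh : 0 < h) (hh' : h < 1 / 2) :
    missProb a h 0 0 < 1 := by
  obtain ⟨hα, hβ⟩ := posterior_param_pos (s := 0) (t := 0) ha le_rfl
  have := isProbabilityMeasureBeta hα hβ
  have hB := beta_pos hα hβ
  refine (missProb_le a h 0 0 0).trans_lt ?_
  have hpos : 0 < (betaMeasure (a + (0 : ℕ)) (a + (0 : ℕ) - (0 : ℕ))).real (Ioo 0 h) :=
    lt_of_lt_of_le (by have : 0 < 1 - h := by linarith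
                       positivity)
      (betaMeasure_real_Ioo_zero hα hβ hh (by linarith))
  have hle : (betaMeasure (a + (0 : ℕ)) (a + (0 : ℕ) - (0 : ℕ))).real {u | h < |0 - u|} ≤
      (betaMeasure (a + (0 : ℕ)) (a + (0 : ℕ) - (0 : ℕ))).real (Ioo 0 h)ᶜ := by
    refine measureReal_mono fun u hu hu' => ?_
    rw [mem_ofPred_eq, zero_sub, abs_neg, abs_of_pos hu'.1] at hu
    linarith [hu'.2]
  rw [probReal_compl_eq_one_sub measurableSet_Ioo] at hle
  linarith

end MissProb

/-! ### Gamma and Beta estimates uniform in the number of successes. -/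

section Gamma

/-- `Γ(δ + i) / Γ(δ)` and `Γ(δ + i + j + 1) / Γ(δ + j + 1)` are both products of `i` consecutive
factors, and those of the second are larger. -/
theorem Gamma_mul_Gamma_add_one_le {δ : ℝ} (hδ : 0 < δ) (i j : ℕ) :
    Real.Gamma (δ + i) * Real.Gamma (δ + j + 1) ≤ Real.Gamma δ * Real.Gamma (δ + (i + j : ℕ) + 1) := by
  induction i with
  | zero => simp
  | succ i ih =>
    have e1 : Real.Gamma (δ + (i + 1 : ℕ)) = (δ + i) * Real.Gamma (δ + i) := by
      rw [← Real.Gamma_add_one (by positivity)]; push_cast; ring_nf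
    have e2 : Real.Gamma (δ + (i + 1 + j : ℕ) + 1) =
        (δ + (i + j : ℕ) + 1) * Real.Gamma (δ + (i + j : ℕ) + 1) := by
      rw [← Real.Gamma_add_one (by positivity)]; push_cast; ring_nf
    have hp := Real.Gamma_pos_of_pos (show 0 < δ + (i + j : ℕ) + 1 by positivity)
    have hd := Real.Gamma_pos_of_pos hδ
    rw [e1, e2]
    calc (δ + i) * Real.Gamma (δ + i) * Real.Gamma (δ + j + 1)
        = (δ + i) * (Real.Gamma (δ + i) * Real.Gamma (δ + j + 1)) := by ring
      _ ≤ (δ + i) * (Real.Gamma δ * Real.Gamma (δ + (i + j : ℕ) + 1)) := by gcongr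
      _ ≤ (δ + (i + j : ℕ) + 1) * (Real.Gamma δ * Real.Gamma (δ + (i + j : ℕ) + 1)) := by
          refine mul_le_mul_of_nonneg_right ?_ (by positivity)
          push_cast; linarith [Nat.cast_nonneg (α := ℝ) j]
      _ = _ := by ring

theorem mul_beta_le {δ : ℝ} (hδ : 0 < δ) (hδ1 : δ ≤ 1) {i j : ℕ} (hij : 1 ≤ i + j) :
    (δ + j) * beta (δ + i) (δ + j) ≤ Real.Gamma δ * ((i + j : ℕ) + 2) := by
  have hM : (1 : ℝ) ≤ (i + j : ℕ) := by exact_mod_cast hij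
  set M : ℕ := i + j with hMdef
  have hsum : δ + i + (δ + j) = M + 2 * δ := by rw [hMdef]; push_cast; ring
  have hpos : 0 < Real.Gamma (M + 2 * δ) := Real.Gamma_pos_of_pos (by positivity)
  have hd := Real.Gamma_pos_of_pos hδ
  have e1 : (δ + j) * Real.Gamma (δ + j) = Real.Gamma (δ + j + 1) :=
    (Real.Gamma_add_one (by positivity)).symm
  have e2 : Real.Gamma (δ + M + 1) ≤ (M + 2 * δ) * Real.Gamma (M + 2 * δ) := by
    rw [← Real.Gamma_add_one (by positivity)]
    -- `Γ` is known to be increasing on `[2, ∞)`; this is where `1 ≤ i + j` enters.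
    exact Real.Gamma_strictMonoOn_Ici.monotoneOn (Set.mem_Ici.2 (by linarith))
      (Set.mem_Ici.2 (by linarith)) (by linarith)
  rw [beta, hsum, ← mul_div_assoc, div_le_iff₀ hpos]
  calc (δ + j) * (Real.Gamma (δ + i) * Real.Gamma (δ + j))
      = Real.Gamma (δ + i) * Real.Gamma (δ + j + 1) := by rw [← e1]; ring
    _ ≤ Real.Gamma δ * Real.Gamma (δ + M + 1) := Gamma_mul_Gamma_add_one_le hδ i j
    _ ≤ Real.Gamma δ * ((M + 2 * δ) * Real.Gamma (M + 2 * δ)) := by gcongr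
    _ ≤ Real.Gamma δ * ((M + 2) * Real.Gamma (M + 2 * δ)) := by gcongr; linarith
    _ = _ := by ring

theorem one_le_Gamma_of_mem_Ioc {δ : ℝ} (hδ : 0 < δ) (hδ1 : δ ≤ 1) : 1 ≤ Real.Gamma δ := by
  rw [← Real.Gamma_one]
  exact Real.Gamma_strictAntiOn_Ioc.antitoneOn ⟨hδ, hδ1⟩ ⟨one_pos, le_rfl⟩ hδ1

theorem pow_mul_rpow_le {p q δ : ℝ} (hq : 0 < q) (hqp : q ≤ p) (i j : ℕ) :
    q ^ (i + j) * (p * q) ^ δ ≤ p ^ (δ + i) * q ^ (δ + j) := by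
  have hp : 0 < p := hq.trans_le hqp
  rw [Real.rpow_add_natCast hp.ne', Real.rpow_add_natCast hq.ne', Real.mul_rpow hp.le hq.le, pow_add]
  have h1 : q ^ i ≤ p ^ i := by gcongr
  have h2 : 0 < p ^ δ * q ^ δ * q ^ j := by positivity
  nlinarith

end Gamma

/-! ### Splitting `a` as `n_a + δ_a`. -/

section IntFracPart

variable {a : ℝ}

theorem exists_nat_eq_intPart (ha : 0 < a) : ∃ m : ℕ, intPart a = m := by
  have h : 0 < ⌈a⌉ := Int.ceil_pos.2 ha
  refine ⟨(⌈a⌉ - 1).toNat, ?_⟩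
  rw [intPart]
  have : (((⌈a⌉ - 1).toNat : ℤ) : ℝ) = ((⌈a⌉ - 1 : ℤ) : ℝ) := by
    rw [Int.toNat_of_nonneg (by omega)]
  push_cast at this
  exact this.symm

theorem fracPart_pos (a : ℝ) : 0 < fracPart a := by
  rw [fracPart, intPart]
  linarith [Int.ceil_lt_add_one a]

theorem fracPart_le_one (a : ℝ) : fracPart a ≤ 1 := by
  rw [fracPart, intPart]
  linarith [Int.le_ceil a]

end IntFracPart

/-- Writing `a = m + δ` makes both posterior parameters `δ` plus a natural number, with naturals
summing to `2 * m + t`. Numerator and denominator of each tail bound are then controlled through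
this sum alone, so `s` disappears. -/
theorem geometric_le_missProb {a h : ℝ} (ha : 0 < a) (hh : 0 < h) (hh' : h < 1 / 2) {t s m : ℕ}
    (hs : s ≤ t) (hm : intPart a = m) (hM : 1 ≤ 2 * m + t) :
    (1 / 2 - h) ^ (2 * m + t) * (1 / 4 - h ^ 2) ^ fracPart a /
      (Real.Gamma (fracPart a) * ((2 * m + t : ℕ) + 2)) ≤ missProb a h t s := by
  set δ := fracPart a with hδdef
  have hδ : 0 < δ := fracPart_pos a
  have hδ1 : δ ≤ 1 := fracPart_le_one a
  have ham : a = m + δ := by rw [hδdef, fracPart, hm]; ring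
  obtain ⟨j, rfl⟩ := Nat.exists_eq_add_of_le hs
  have hα : a + s = δ + (m + s : ℕ) := by rw [ham]; push_cast; ring
  have hβ : a + (s + j : ℕ) - s = δ + (m + j : ℕ) := by rw [ham]; push_cast; ring
  have hq : 0 < 1 / 2 - h := by linarith
  have hqp : 1 / 2 - h ≤ 1 / 2 + h := by linarith
  have hw : (1 / 4 - h ^ 2 : ℝ) = (1 / 2 + h) * (1 / 2 - h) := by ring
  have hMeq : 2 * m + (s + j) = (m + s) + (m + j) := by ring
  have hMeq' : 2 * m + (s + j) = (m + j) + (m + s) := by ring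
  have hcomm : beta (δ + (m + s : ℕ)) (δ + (m + j : ℕ)) =
      beta (δ + (m + j : ℕ)) (δ + (m + s : ℕ)) := by
    unfold beta; rw [mul_comm, add_comm (δ + _)]
  have hB := beta_pos (show 0 < δ + (m + s : ℕ) by positivity)
    (show 0 < δ + (m + j : ℕ) by positivity)
  have hG := Real.Gamma_pos_of_pos hδ
  refine le_missProb ha hh hh' hs ?_ ?_ <;> rw [hα, hβ, hw]
  · refine div_le_div₀ (by positivity) ?_ (by positivity) ?_
    · rw [hMeq]; exact pow_mul_rpow_le hq hqp _ _
    · rw [hMeq]; exact mul_beta_le hδ hδ1 (by omega)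
  · refine div_le_div₀ (by positivity) ?_ (by positivity) ?_
    · rw [hMeq', mul_comm ((1 / 2 - h) ^ (δ + _))]; exact pow_mul_rpow_le hq hqp _ _
    · rw [hMeq', hcomm]; exact mul_beta_le hδ hδ1 (by omega)

/-! ### The backward recursion and the upper bound `N`. -/

section Recursion

variable {a h c : ℝ}

theorem predProb_pos (ha : 0 < a) (t s : ℕ) : 0 < predProb a t s := by
  unfold predProb; positivity

theorem predProb_lt_one (ha : 0 < a) {t s : ℕ} (hs : s ≤ t) : predProb a t s < 1 := by
  have : (s : ℝ) ≤ t := by exact_mod_cast hs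
  rw [predProb, div_lt_one (by positivity)]
  linarith

theorem residualCost_le_missProb (a h c : ℝ) (k t s : ℕ) :
    residualCost a h c k t s ≤ missProb a h t s := by
  cases k with
  | zero => exact le_rfl
  | succ k => exact min_le_left _ _

theorem residualCost_nonneg (ha : 0 < a) (hc : 0 ≤ c) (k : ℕ) {t s : ℕ} (hs : s ≤ t) :
    0 ≤ residualCost a h c k t s := by
  induction k generalizing t s with
  | zero => exact missProb_nonneg a h t s
  | succ k ih =>
    have h1 := predProb_pos ha t s
    have h2 := predProb_lt_one ha hs
    have h3 := ih (Nat.succ_le_succ hs)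
    have h4 := ih (Nat.le_succ_of_le hs)
    refine le_min (missProb_nonneg a h t s) (add_nonneg hc (add_nonneg (by positivity) ?_))
    exact mul_nonneg (by linarith) h4

/-- Continuing costs at least `c`, because later residual costs are nonnegative. -/
theorem residualCost_eq_missProb (ha : 0 < a) (hc : 0 ≤ c) (k : ℕ) {t s : ℕ} (hs : s ≤ t)
    (hle : missProb a h t s ≤ c) : residualCost a h c k t s = missProb a h t s := by
  cases k with
  | zero => rfl
  | succ k =>
    have h1 := predProb_pos ha t s
    have h2 := predProb_lt_one ha hs
    have h3 := residualCost_nonneg (h := h) ha hc k (Nat.succ_le_succ hs)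
    have h4 := residualCost_nonneg (h := h) ha hc k (Nat.le_succ_of_le hs)
    refine min_eq_left (hle.trans (le_add_of_nonneg_right (add_nonneg (by positivity) ?_)))
    exact mul_nonneg (by linarith) h4

/-- Sampling until a fixed time `N ≤ H` at which every posterior miss probability is below `c`. -/
theorem residualCost_lt (ha : 0 < a) {N : ℕ} (hN : ∀ s ≤ N, missProb a h N s < c) (k : ℕ)
    {t s : ℕ} (hs : s ≤ t) (htN : t ≤ N) (hNk : N ≤ t + k) :
    residualCost a h c k t s < c * (N - t) + c := by
  induction k generalizing t s with
  | zero =>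
    obtain rfl : t = N := by omega
    simpa [residualCost] using hN s hs
  | succ k ih =>
    rcases htN.eq_or_lt with rfl | hlt
    · exact (residualCost_le_missProb a h c _ _ _).trans_lt (by simpa using hN s hs)
    have h1 := predProb_pos ha t s
    have h2 := predProb_lt_one ha hs
    have h3 := ih (Nat.succ_le_succ hs) hlt (by omega)
    have h4 := ih (Nat.le_succ_of_le hs) hlt (by omega)
    refine (min_le_right _ _).trans_lt ?_
    push_cast at h3 h4
    set p := predProb a t s
    have h5 := mul_lt_mul_of_pos_left h3 h1
    have h6 := mul_lt_mul_of_pos_left h4 (show 0 < 1 - p by linarith)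
    nlinarith

theorem successes_le (x : ℕ → Bool) (t : ℕ) : successes x t ≤ t := by
  unfold successes
  calc ∑ i ∈ Finset.range t, (x i).toNat ≤ ∑ i ∈ Finset.range t, 1 :=
        Finset.sum_le_sum fun i _ => Bool.toNat_le (x i)
    _ = t := by simp

theorem optTime_spec (a h c : ℝ) (H : ℕ) (x : ℕ → Bool) :
    optTime a h c H x ≤ H ∧
      residualCost a h c (H - optTime a h c H x) (optTime a h c H x)
        (successes x (optTime a h c H x)) =
      missProb a h (optTime a h c H x) (successes x (optTime a h c H x)) :=
  Nat.sInf_mem (s := {t | t ≤ H ∧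
    residualCost a h c (H - t) t (successes x t) = missProb a h t (successes x t)})
    ⟨H, le_rfl, by rw [Nat.sub_self]; rfl⟩

theorem optTime_le {H t : ℕ} {x : ℕ → Bool} (ht : t ≤ H)
    (heq : residualCost a h c (H - t) t (successes x t) = missProb a h t (successes x t)) :
    optTime a h c H x ≤ t :=
  Nat.sInf_le ⟨ht, heq⟩

theorem optTime_eq_zero (ha : 0 < a) (hc : 0 ≤ c) (hle : missProb a h 0 0 ≤ c) (H : ℕ)
    (x : ℕ → Bool) : optTime a h c H x = 0 := by
  refine Nat.le_zero.1 (optTime_le (Nat.zero_le H) ?_)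
  have hs : successes x 0 = 0 := by simp [successes]
  rw [hs]
  exact residualCost_eq_missProb ha hc _ le_rfl hle

theorem le_upperTime (a h c : ℝ) :
    (|Real.log c| + Real.log 2) / (2 * h ^ 2) - 2 * a - 1 ≤ upperTime a h c :=
  (le_max_right _ _).trans (Nat.le_ceil _)

theorem missProb_upperTime_lt (ha : 0 < a) (hh : 0 < h) (hc : 0 < c) (hc1 : c ≤ 1) {s : ℕ}
    (hs : s ≤ upperTime a h c) : missProb a h (upperTime a h c) s < c := by
  refine (missProb_lt ha hh hs).trans_le ?_
  have hN := le_upperTime a h c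
  rw [abs_of_nonpos (Real.log_nonpos hc.le hc1)] at hN
  have h1 : (-Real.log c + Real.log 2) ≤ 2 * h ^ 2 * (upperTime a h c + 2 * a + 1) := by
    have : (-Real.log c + Real.log 2) / (2 * h ^ 2) ≤ upperTime a h c + 2 * a + 1 := by linarith
    rwa [div_le_iff₀' (by positivity)] at this
  calc 2 * Real.exp (-(2 * h ^ 2 * (upperTime a h c + 2 * a + 1)))
      ≤ 2 * Real.exp (Real.log c - Real.log 2) := by gcongr; linarith
    _ = c := by rw [Real.exp_sub, Real.exp_log hc, Real.exp_log two_pos]; ring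

theorem missProb_upperTime_le (ha : 0 < a) (hh : 0 < h) (hc : 0 < c) {s : ℕ}
    (hs : s ≤ upperTime a h c) : missProb a h (upperTime a h c) s ≤ c := by
  rcases le_total c 1 with hc1 | hc1
  · exact (missProb_upperTime_lt ha hh hc hc1 hs).le
  · exact (missProb_le_one ha hs).trans hc1

theorem optTime_le_upperTime (ha : 0 < a) (hh : 0 < h) (hc : 0 < c) (H : ℕ) (x : ℕ → Bool) :
    optTime a h c H x ≤ upperTime a h c := by
  rcases le_total (upperTime a h c) H with hN | hN
  · exact optTime_le hN (residualCost_eq_missProb ha hc.le _ (successes_le x _)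
      (missProb_upperTime_le ha hh hc (successes_le x _)))
  · exact (optTime_spec a h c H x).1.trans hN

/-- An elementary lower bound for the rate `|log (1/2 - h)|`. -/
theorem log_two_add_le (hh : 0 < h) (hh' : h < 1 / 2) :
    Real.log 2 + 2 * h + 2 * h ^ 2 ≤ -Real.log (1 / 2 - h) := by
  -- The first two terms of the series of `-log (1 - 2h)` are `2h` and `2h²`.
  have hs := Real.hasSum_pow_div_log_of_abs_lt_one (x := 2 * h) (by rw [abs_lt]; constructor <;> linarith)
  have := hs.summable.sum_le_tsum (Finset.range 2) (fun i _ => by positivity)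
  rw [hs.tsum_eq] at this
  have e : (1 / 2 - h : ℝ) = (1 - 2 * h) / 2 := by ring
  rw [e, Real.log_div (by linarith) (by norm_num)]
  simp [Finset.sum_range_succ] at this
  linarith

end Recursion

/-! ### The lower bound `ν` and the logarithmic rates. -/

section LowerTime

variable {a h c : ℝ}

theorem mul_rate_le_of_le_lowerTime (hh : 0 < h) (hh' : h < 1 / 2) (hc : 0 < c) (hc1 : c < 1)
    {m t : ℕ} (hm : intPart a = m) (ht : t + 1 ≤ lowerTime a h c) :
    (2 * m + t + 1) * -Real.log (1 / 2 - h) ≤ -Real.log c -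
      Real.log ((upperTime a h c + 2 * m + fracPart a) ^ 2 * Real.Gamma (fracPart a)) +
      Real.log (8 * (1 / 4 - h ^ 2) ^ fracPart a) := by
  have hq : Real.log (1 / 2 - h) < 0 := Real.log_neg (by linarith) (by linarith)
  rw [lowerTime, Nat.le_floor_iff' (by omega), le_max_iff] at ht
  rcases ht with ht | ht
  · push_cast at ht
    linarith [Nat.cast_nonneg (α := ℝ) t]
  · rw [hm, abs_of_neg hq, abs_of_neg (Real.log_neg hc hc1), le_sub_iff_add_le,
      le_div_iff₀ (by linarith)] at ht
    push_cast at ht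
    linarith

/-- After division by `2 h²`, using `h < 1/2`, the bound becomes linear in `m` plus `4 log n`. It is
then bootstrapped: `n ≥ 4` improves to `n ≥ 8` through `log n`, and `log n ≥ 3 log 2` gives the
claim. -/
theorem four_mul_le_of_log_bound {n m : ℝ} (hh : 0 < h) (hh' : h < 1 / 2) (hm : 1 ≤ m)
    (hn : 1 ≤ n)
    (hle : (m + 1) * (Real.log 2 + 2 * h + 2 * h ^ 2) + 2 * Real.log n - 2 * Real.log 2 ≤
      2 * h ^ 2 * (n + 2)) : 4 * (m + 2) ≤ n := by
  have hl2 : 0.69 ≤ Real.log 2 := by linarith [Real.log_two_gt_d9]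
  have hhsq : 0 < h ^ 2 := by positivity
  have h2 : 2 * h ^ 2 ≤ h := by nlinarith
  have h4 : h ^ 2 ≤ 1 / 4 := by nlinarith
  have hlog : 0 ≤ Real.log n := Real.log_nonneg hn
  have hmain : 3 * (m + 1) + 1.38 * (m - 1) + 4 * Real.log n - 2 ≤ n := by
    have e1 : 4 * h ^ 2 * (m + 1) ≤ 2 * h * (m + 1) := by nlinarith
    have e2 : 2.76 * h ^ 2 * (m - 1) ≤ Real.log 2 * (m - 1) :=
      mul_le_mul_of_nonneg_right (by linarith) (by linarith)
    have e3 : 8 * h ^ 2 * Real.log n ≤ 2 * Real.log n := by nlinarith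
    have : 2 * h ^ 2 * (3 * (m + 1) + 1.38 * (m - 1) + 4 * Real.log n) ≤ 2 * h ^ 2 * (n + 2) := by
      linarith
    linarith [le_of_mul_le_mul_left this (by positivity)]
  have hn4 : 4 ≤ n := by linarith
  have hlog4 : 2 * Real.log 2 ≤ Real.log n := by
    rw [← Real.log_rpow two_pos]
    exact Real.log_le_log (by positivity) (by norm_num; linarith)
  have hn8 : 8 ≤ n := by linarith
  have hlog8 : 3 * Real.log 2 ≤ Real.log n := by
    rw [← Real.log_rpow two_pos]
    exact Real.log_le_log (by positivity) (by norm_num; linarith)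
  linarith

theorem lowerTime_le_optTime (ha : 0 < a) (hh : 0 < h) (hh' : h < 1 / 2) (hc : 0 < c)
    (hcond : c * (upperTime a h c + 1) ≤ missProb a h 0 0) {H : ℕ} (hH : upperTime a h c ≤ H)
    (x : ℕ → Bool) : lowerTime a h c ≤ optTime a h c H x := by
  by_contra hcon
  push Not at hcon
  have hspec := (optTime_spec a h c H x).2
  have hTH := (optTime_spec a h c H x).1
  have hTN := optTime_le_upperTime ha hh hc H x
  set T := optTime a h c H x
  have hlowerN := le_upperTime a h c
  have hc1 : c < 1 := by
    have := missProb_zero_lt_one ha hh hh'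
    nlinarith [Nat.cast_nonneg (α := ℝ) (upperTime a h c)]
  have hlt := residualCost_lt ha (fun s hs => missProb_upperTime_lt ha hh hc hc1.le hs) (H - T)
    (successes_le x T) hTN (by omega)
  rw [hspec] at hlt
  -- At `T = 0` the smallness condition contradicts `hlt` directly. The geometric bound serves `T ≥
  -- 1`, where `N - T + 1 ≤ n`.
  rcases Nat.eq_zero_or_pos T with hT0 | hT1
  · have hs : successes x T = 0 := by rw [hT0]; simp [successes]
    rw [hs, hT0] at hlt
    push_cast at hlt
    linarith
  obtain ⟨m, hm⟩ := exists_nat_eq_intPart ha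
  have hrate := mul_rate_le_of_le_lowerTime hh hh' hc hc1 hm hcon
  have hgeo := geometric_le_missProb ha hh hh' (successes_le x T) hm (by omega)
  have hT1' : (1 : ℝ) ≤ T := by exact_mod_cast hT1
  have hTN' : (T : ℝ) ≤ upperTime a h c := by exact_mod_cast hTN
  have ham : a = m + fracPart a := by rw [fracPart, hm]; ring
  have hδ := fracPart_pos a
  have hδ1 := fracPart_le_one a
  set δ := fracPart a
  set N : ℝ := (upperTime a h c : ℝ)
  have hΓ := one_le_Gamma_of_mem_Ioc hδ hδ1
  set G := Real.Gamma δ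
  have hq : 0 < 1 / 2 - h := by linarith
  have hw0 : 0 < 1 / 4 - h ^ 2 := by nlinarith
  set w := (1 / 4 - h ^ 2) ^ δ with hw
  have hwpos : 0 < w := Real.rpow_pos_of_pos hw0 δ
  have hw1 : w ≤ 1 := Real.rpow_le_one hw0.le (by nlinarith) hδ.le
  have hm0 : (0 : ℝ) ≤ m := Nat.cast_nonneg m
  set n : ℝ := N + 2 * m + δ with hn
  have hnpos : 1 ≤ n := by linarith
  set M : ℕ := 2 * m + T with hM
  have hMcast : (M : ℝ) = 2 * m + T := by rw [hM]; push_cast; ring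
  -- The defining inequality of `ν`, exponentiated; the exponent is `M + 1` because `T + 1 ≤ ν`.
  have hsmall : c * (n ^ 2 * G) ≤ 8 * w * (1 / 2 - h) ^ (M + 1) := by
    rw [← Real.log_le_log_iff (by positivity) (by positivity), Real.log_mul hc.ne' (by positivity),
      Real.log_mul (x := 8 * w) (by positivity) (by positivity), Real.log_pow]
    push_cast
    rw [hMcast]
    linarith
  -- Eliminates `log c` between the definitions of `N` and `ν`. One of the two factors `n` in
  -- `hsmall` then absorbs the linear factor `M + 2` of the geometric bound, the constant `8` being
  -- `4` times the `2` from `1/2 - h ≤ 1/2`.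
  have hlarge : 4 * ((M : ℝ) + 2) ≤ n := by
    refine four_mul_le_of_log_bound hh hh' (by linarith) hnpos ?_
    have h1 : -Real.log c + Real.log 2 ≤ 2 * h ^ 2 * (n + 2) := by
      rw [abs_of_neg (Real.log_neg hc hc1)] at hlowerN
      have : (-Real.log c + Real.log 2) / (2 * h ^ 2) ≤ n + 2 := by linarith
      rwa [div_le_iff₀' (by positivity)] at this
    have h2 : (2 * m + T + 1) * (Real.log 2 + 2 * h + 2 * h ^ 2) ≤
        (2 * m + T + 1) * -Real.log (1 / 2 - h) :=
      mul_le_mul_of_nonneg_left (log_two_add_le hh hh') (by positivity)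
    have h3 : 2 * Real.log n ≤ Real.log (n ^ 2 * G) := by
      rw [Real.log_mul (by positivity) (by positivity), Real.log_pow]
      push_cast
      linarith [Real.log_nonneg hΓ]
    have h4 : Real.log (8 * w) ≤ 3 * Real.log 2 := by
      rw [← Real.log_rpow two_pos]
      exact Real.log_le_log (by positivity) (by norm_num; linarith)
    rw [hMcast]
    linarith
  have hpow : 0 < (1 / 2 - h) ^ M := by positivity
  rw [pow_succ (1 / 2 - h)] at hsmall
  set P := (1 / 2 - h) ^ M
  have hfin : c * n ≤ P * w / (G * (M + 2)) := by
    rw [le_div_iff₀ (by positivity)]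
    have h1 : c * n * G * (4 * (M + 2)) ≤ c * n * G * n :=
      mul_le_mul_of_nonneg_left hlarge (by positivity)
    have h2 : 8 * w * (P * (1 / 2 - h)) ≤ 8 * w * (P * (1 / 2)) := by gcongr; linarith
    have h3 : c * n * G * n = c * (n ^ 2 * G) := by ring
    linarith
  have hcn : c * (N - T + 1) ≤ c * n := mul_le_mul_of_nonneg_left (by linarith) hc.le
  linarith

theorem upperTime_le_of_lt_one (hh : 0 < h) (ha : 0 < a) (hc : 0 < c) (hc1 : c < 1) :
    (upperTime a h c : ℝ) ≤ (-Real.log c + Real.log 2) / (2 * h ^ 2) + 1 := by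
  have hl2 := Real.log_pos one_lt_two
  have hlc := Real.log_neg hc hc1
  have hpos : 0 ≤ (-Real.log c + Real.log 2) / (2 * h ^ 2) := div_nonneg (by linarith) (by positivity)
  refine (Nat.ceil_lt_add_one (le_max_left _ _)).le.trans (add_le_add_left (max_le hpos ?_) 1)
  rw [abs_of_neg hlc]
  linarith

/-- The danger is `c` near `1`, where `|log c|` vanishes; but for `c ≥ 𝒞_0`, with `𝒞_0 < 1`, no
observation is taken. For `c < 𝒞_0`, `|log c|` exceeds `-log 𝒞_0` and absorbs the additive
constants. The parameter `B` lets the constant exceed the lower rate. -/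
theorem exists_optTime_le_mul_abs_log (ha : 0 < a) (hh : 0 < h) (hh' : h < 1 / 2) (B : ℝ) :
    ∃ C : ℝ, B < C ∧ ∀ c : ℝ, 0 < c → ∀ (H : ℕ) (x : ℕ → Bool),
      (optTime a h c H x : ℝ) ≤ C * |Real.log c| := by
  have hp0 := missProb_pos (t := 0) (s := 0) ha hh hh' le_rfl
  have hp1 := missProb_zero_lt_one ha hh hh'
  set p := missProb a h 0 0 with hp
  have hlp : 0 < -Real.log p := by linarith [Real.log_neg hp0 hp1]
  have hl2 := Real.log_pos one_lt_two
  set D := 1 / (2 * h ^ 2) + (Real.log 2 / (2 * h ^ 2) + 1) / -Real.log p with hD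
  refine ⟨max (B + 1) D, (lt_add_one B).trans_le (le_max_left _ _), fun c hc H x => ?_⟩
  have hDle := le_max_right (B + 1) D
  have hDpos : 0 < D := by positivity
  rcases le_or_gt p c with hpc | hcp
  · rw [optTime_eq_zero ha hc.le hpc, Nat.cast_zero]
    exact mul_nonneg (hDpos.le.trans hDle) (abs_nonneg _)
  · have hc1 : c < 1 := hcp.trans hp1
    have hlt : Real.log c < Real.log p := Real.log_lt_log hc hcp
    have hup := upperTime_le_of_lt_one hh ha hc hc1
    have hT : (optTime a h c H x : ℝ) ≤ upperTime a h c := by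
      exact_mod_cast optTime_le_upperTime ha hh hc H x
    rw [abs_of_neg (Real.log_neg hc hc1)]
    refine (hT.trans hup).trans (le_trans ?_ (mul_le_mul_of_nonneg_right hDle (by linarith)))
    rw [hD, add_mul, add_div, add_assoc, one_div_mul_eq_div]
    refine add_le_add le_rfl ?_
    rw [div_mul_eq_mul_div, le_div_iff₀ hlp]
    exact mul_le_mul_of_nonneg_left (by linarith) (by positivity)

theorem exists_forall_small_cost (ha : 0 < a) (hh : 0 < h) (hh' : h < 1 / 2) :
    ∃ c₀ : ℝ, 0 < c₀ ∧ ∀ c : ℝ, 0 < c → c ≤ c₀ →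
      0 < |Real.log c| ∧ c * (upperTime a h c + 1) ≤ missProb a h 0 0 ∧
      1 / (2 * |Real.log (1 / 2 - h)|) * |Real.log c| ≤ lowerTime a h c := by
  obtain ⟨m, hm⟩ := exists_nat_eq_intPart ha
  have hδ := fracPart_pos a
  set δ := fracPart a with hδdef
  have hG := Real.Gamma_pos_of_pos hδ
  set G := Real.Gamma δ
  have hl2 := Real.log_pos one_lt_two
  have hp0 := missProb_pos (t := 0) (s := 0) ha hh hh' le_rfl
  have hlq : Real.log (1 / 2 - h) < 0 := Real.log_neg (by linarith) (by linarith)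
  set r := -Real.log (1 / 2 - h) with hr
  have hrpos : 0 < r := by linarith
  set W := Real.log (8 * (1 / 4 - h ^ 2) ^ δ) with hW
  set K := 1 / (2 * h ^ 2) + (Real.log 2 / (2 * h ^ 2) + 2 + 2 * m + δ) with hK
  have hKpos : 0 < K := by positivity
  have hA : ∀ᶠ l : ℝ in Filter.atTop, K * (l ^ 1 * Real.exp (-l)) ≤ missProb a h 0 0 := by
    have := (Real.tendsto_pow_mul_exp_neg_atTop_nhds_zero 1).const_mul K
    rw [mul_zero] at this
    exact this.eventually_le_const hp0
  have hB : ∀ᶠ l : ℝ in Filter.atTop, Real.log l ≤ l / 8 := by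
    filter_upwards [Real.isLittleO_log_id_atTop.def (show (0 : ℝ) < 1 / 8 by norm_num),
      Filter.eventually_ge_atTop 1] with l hl hl1
    rw [Real.norm_eq_abs, id, Real.norm_eq_abs, abs_of_nonneg (by linarith : (0 : ℝ) ≤ l)] at hl
    linarith [le_abs_self (Real.log l)]
  -- With `l = |log c|`, claiming only half the rate `1 / r` leaves `l / 2` to spare: one quarter of
  -- `l` pays for `2 log l`, the other for the constants, including an extra `r` that covers the
  -- floor.
  obtain ⟨l₀, hl₀⟩ := Filter.eventually_atTop.1 ((hA.and hB).and ((Filter.eventually_ge_atTop 1).and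
    (Filter.eventually_ge_atTop (4 * (2 * Real.log K + Real.log G - W + (2 * m + 1) * r)))))
  refine ⟨Real.exp (-l₀), Real.exp_pos _, fun c hc hcle => ?_⟩
  have hl : l₀ ≤ -Real.log c := by
    have := Real.log_le_log hc hcle
    rw [Real.log_exp] at this
    linarith
  obtain ⟨⟨h1, h2⟩, h3, h4⟩ := hl₀ _ hl
  have hexp : Real.exp (-(-Real.log c)) = c := by rw [neg_neg, Real.exp_log hc]
  rw [hexp] at h1
  have hlc : Real.log c < 0 := by linarith
  have hc1 : c < 1 := (Real.log_neg_iff hc).1 hlc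
  have hup := upperTime_le_of_lt_one hh ha hc hc1
  set l := -Real.log c with hldef
  have hl0 : 0 < l := by linarith
  set N := upperTime a h c with hN
  have hNK : (N : ℝ) + 1 + 2 * m + δ ≤ K * l := by
    rw [add_div] at hup
    have : Real.log 2 / (2 * h ^ 2) + 2 + 2 * m + δ ≤
        (Real.log 2 / (2 * h ^ 2) + 2 + 2 * m + δ) * l :=
      le_mul_of_one_le_right (by positivity) h3
    rw [hK, add_mul, one_div_mul_eq_div]
    linarith
  have hm0 : (0 : ℝ) ≤ m := Nat.cast_nonneg m
  have hN0 : (0 : ℝ) ≤ N := Nat.cast_nonneg N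
  rw [abs_of_neg hlc, abs_of_neg hlq]
  refine ⟨hl0, ?_, ?_⟩
  · calc c * ((N : ℝ) + 1) ≤ c * (K * l) := by gcongr; linarith
      _ = K * (l ^ 1 * c) := by ring
      _ ≤ _ := h1
  · have hlog : Real.log (((N : ℝ) + 2 * m + δ) ^ 2 * G) ≤ 2 * Real.log K + 2 * Real.log l + Real.log G := by
      rw [Real.log_mul (by positivity) hG.ne', Real.log_pow]
      have := Real.log_le_log (by positivity) (show (N : ℝ) + 2 * m + δ ≤ K * l by linarith)
      rw [Real.log_mul hKpos.ne' hl0.ne'] at this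
      push_cast
      linarith
    have hY : 1 / (2 * r) * l + 1 ≤
        (l - Real.log (((N : ℝ) + 2 * m + δ) ^ 2 * G) + W) / r - 2 * m := by
      rw [le_sub_iff_add_le, le_div_iff₀ hrpos]
      have : (1 / (2 * r) * l + 1 + 2 * m) * r = l / 2 + (2 * m + 1) * r := by
        field_simp
        ring
      rw [this]
      linarith
    have hfl := (Nat.lt_floor_add_one (max 0 ((l - Real.log (((N : ℝ) + 2 * m + δ) ^ 2 * G) + W) / r
      - 2 * m))).le
    have hmax := le_max_right 0 ((l - Real.log (((N : ℝ) + 2 * m + δ) ^ 2 * G) + W) / r - 2 * m)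
    rw [lowerTime, hm, abs_of_neg hlc, abs_of_neg hlq]
    have hfin : 1 / (2 * r) * l ≤
        ⌊max 0 ((l - Real.log (((N : ℝ) + 2 * m + δ) ^ 2 * G) + W) / r - 2 * m)⌋₊ := by linarith
    exact hfin

end LowerTime

/-! ### Existence of an optimal mid-point. -/

section Minimizer

open Set

variable {α β : ℝ}

/-- Dominated convergence: the indicator is continuous in `m` at `m₀` except for `u = m₀ ± h`, and
the law has no atoms. -/
theorem continuous_betaMeasure_real_deviation (hα : 0 < α) (hβ : 0 < β) (h : ℝ) :
    Continuous fun m : ℝ => (betaMeasure α β).real {u | h < |m - u|} := by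
  have := isProbabilityMeasureBeta hα hβ
  have hmeas : ∀ m : ℝ, MeasurableSet {u : ℝ | h < |m - u|} := fun m =>
    measurableSet_lt measurable_const (by fun_prop)
  simp_rw [fun m => (integral_indicator_one (μ := betaMeasure α β) (hmeas m)).symm]
  refine continuous_iff_continuousAt.2 fun m₀ => ?_
  refine continuousAt_of_dominated (bound := fun _ => 1) ?_ ?_ (integrable_const 1) ?_
  · exact Filter.Eventually.of_forall fun m =>
      (measurable_one.indicator (hmeas m)).aestronglyMeasurable
  · refine Filter.Eventually.of_forall fun m => Filter.Eventually.of_forall fun u => ?_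
    by_cases hu : u ∈ {u : ℝ | h < |m - u|} <;> simp [Set.indicator, hu]
  · have hnull : betaMeasure α β {m₀ - h, m₀ + h} = 0 :=
      withDensity_absolutelyContinuous _ _ (Set.Finite.measure_zero (by simp) volume)
    filter_upwards [measure_eq_zero_iff_ae_notMem.1 hnull] with u hu
    have hcont : Continuous fun m : ℝ => |m - u| := by fun_prop
    have hne : |m₀ - u| ≠ h := by
      intro heq
      apply hu
      rcases abs_choice (m₀ - u) with h1 | h1 <;> rw [h1] at heq
      · left; linarith
      · right; rw [mem_singleton_iff]; linarith
    rcases hne.lt_or_gt with hlt | hlt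
    · refine (continuousAt_const (y := (0 : ℝ))).congr ?_
      filter_upwards [hcont.continuousAt.eventually_lt_const hlt] with m hm
      rw [indicator_of_notMem]
      simpa using hm.le
    · refine (continuousAt_const (y := (1 : ℝ))).congr ?_
      filter_upwards [hcont.continuousAt.eventually_const_lt hlt] with m hm
      rw [indicator_of_mem (by simpa using hm)]
      rfl

theorem exists_missProb_eq {a : ℝ} (ha : 0 < a) (h : ℝ) {t s : ℕ} (hs : s ≤ t) :
    ∃ m : ℝ, (betaMeasure (a + s) (a + t - s)).real {u | h < |m - u|} = missProb a h t s := by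
  obtain ⟨hα, hβ⟩ := posterior_param_pos ha hs
  have := isProbabilityMeasureBeta hα hβ
  obtain ⟨m, -, hm⟩ := (isCompact_Icc (a := (0 : ℝ)) (b := 1)).exists_isMinOn ⟨0, by simp⟩
    (continuous_betaMeasure_real_deviation hα hβ h).continuousOn
  refine ⟨m, le_antisymm (le_ciInf fun m' => ?_) (missProb_le a h t s m)⟩
  -- Projecting `m'` onto `[0, 1]` brings it no farther from any point of `(0, 1)`, so minimizing
  -- over the compact interval suffices.
  set p : ℝ := max 0 (min 1 m') with hp
  refine (hm (show p ∈ Icc (0 : ℝ) 1 from ⟨le_max_left _ _, max_le zero_le_one (min_le_left _ _)⟩)).trans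
    (ENNReal.toReal_mono (measure_ne_top _ _) (measure_mono_ae ?_))
  filter_upwards [ae_mem_Ioo_betaMeasure (a + s) (a + t - s)] with u hu hlt
  have hlt' : h < |p - u| := hlt
  have : |p - u| ≤ |m' - u| := by
    rcases le_total m' 0 with h0 | h0
    · have : p = 0 := by rw [hp, min_eq_right (by linarith), max_eq_left h0]
      rw [this, abs_of_nonpos (by linarith [hu.1]), abs_of_nonpos (by linarith [hu.1])]
      linarith
    · rcases le_total m' 1 with h1 | h1
      · have : p = m' := by rw [hp, min_eq_right h1, max_eq_right h0]
        rw [this]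
      · have : p = 1 := by rw [hp, min_eq_left h1, max_eq_right zero_le_one]
        rw [this, abs_of_nonneg (by linarith [hu.2]), abs_of_nonneg (by linarith [hu.2])]
        linarith
  exact hlt'.trans_le this

end Minimizer

/-! ### Conjugacy and the law of finite observation sequences. -/

section Cylinder

variable {a : ℝ}

theorem successes_succ (x : ℕ → Bool) (t : ℕ) :
    successes x (t + 1) = successes x t + (x t).toNat :=
  Finset.sum_range_succ _ _

theorem successes_congr {x y : ℕ → Bool} {t : ℕ} (hxy : ∀ i < t, x i = y i) :
    successes x t = successes y t :=
  Finset.sum_congr rfl fun i hi => by rw [hxy i (Finset.mem_range.1 hi)]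

theorem prod_bernoulli_likelihood (x : ℕ → Bool) (t : ℕ) (u : ℝ) :
    ∏ i ∈ Finset.range t, (if x i then u else 1 - u) =
      u ^ successes x t * (1 - u) ^ (t - successes x t) := by
  induction t with
  | zero => simp [successes]
  | succ t ih =>
    rw [Finset.prod_range_succ, ih, successes_succ]
    cases x t with
    | true => simp [pow_succ]; ring
    | false => simp [Nat.succ_sub (successes_le x t), pow_succ]; ring

/-- The marginal probability of a given sequence of `t` observations with `s` successes. -/
noncomputable def seqProb (a : ℝ) (t s : ℕ) : ℝ := beta (a + s) (a + t - s) / beta a a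

theorem seqProb_pos (ha : 0 < a) {t s : ℕ} (hs : s ≤ t) : 0 < seqProb a t s := by
  obtain ⟨hα, hβ⟩ := posterior_param_pos ha hs
  exact div_pos (beta_pos hα hβ) (beta_pos ha ha)

theorem seqProb_succ_succ (ha : 0 < a) {t s : ℕ} (hs : s ≤ t) :
    seqProb a (t + 1) (s + 1) = predProb a t s * seqProb a t s := by
  obtain ⟨hα, hβ⟩ := posterior_param_pos ha hs
  have h1 : a + (s + 1 : ℕ) = a + s + 1 := by push_cast; ring
  have h2 : a + (t + 1 : ℕ) - (s + 1 : ℕ) = a + t - s := by push_cast; ring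
  have h3 : a + s + 1 + (a + t - s) = (t + 2 * a) + 1 := by ring
  have h4 : a + s + (a + t - s) = t + 2 * a := by ring
  have h5 : 0 < (t : ℝ) + 2 * a := by positivity
  have := Real.Gamma_pos_of_pos h5
  rw [seqProb, seqProb, predProb, h1, h2, beta, beta, beta, h3, h4, Real.Gamma_add_one hα.ne',
    Real.Gamma_add_one h5.ne', add_comm (s : ℝ) a]
  field_simp

theorem seqProb_succ (ha : 0 < a) {t s : ℕ} (hs : s ≤ t) :
    seqProb a (t + 1) s = (1 - predProb a t s) * seqProb a t s := by
  obtain ⟨hα, hβ⟩ := posterior_param_pos ha hs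
  have h2 : a + (t + 1 : ℕ) - s = a + t - s + 1 := by push_cast; ring
  have h3 : a + s + (a + t - s + 1) = (t + 2 * a) + 1 := by ring
  have h4 : a + s + (a + t - s) = t + 2 * a := by ring
  have h5 : 0 < (t : ℝ) + 2 * a := by positivity
  have h6 : 1 - ((s : ℝ) + a) / (t + 2 * a) = (a + t - s) / (t + 2 * a) := by
    field_simp; ring
  have := Real.Gamma_pos_of_pos h5
  rw [seqProb, seqProb, predProb, h6, h2, beta, beta, beta, h3, h4, Real.Gamma_add_one hβ.ne',
    Real.Gamma_add_one h5.ne']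
  field_simp

/-- Beta–Bernoulli conjugacy: prior times likelihood is marginal times posterior. -/
theorem betaPDF_mul_likelihood (ha : 0 < a) (x : ℕ → Bool) (t : ℕ) (u : ℝ) :
    betaPDF a a u * ∏ i ∈ Finset.range t, ENNReal.ofReal (if x i then u else 1 - u) =
      ENNReal.ofReal (seqProb a t (successes x t)) *
        betaPDF (a + successes x t) (a + t - successes x t) u := by
  have hs := successes_le x t
  have hprod := prod_bernoulli_likelihood x t u
  set s := successes x t
  obtain ⟨hα, hβ⟩ := posterior_param_pos ha hs
  rw [betaPDF_eq, betaPDF_eq]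
  by_cases hu : 0 < u ∧ u < 1
  · have hu1 : 0 < 1 - u := by linarith [hu.2]
    rw [if_pos hu, if_pos hu, ← ENNReal.ofReal_prod_of_nonneg fun i _ => by
      split_ifs <;> linarith [hu.1], hprod, ← ENNReal.ofReal_mul (by
        have := beta_pos ha ha
        have := hu.1
        positivity), ← ENNReal.ofReal_mul (seqProb_pos ha hs).le]
    congr 1
    have e1 : u ^ (a + s - 1) = u ^ (a - 1) * u ^ s := by
      rw [← Real.rpow_add_natCast hu.1.ne']; ring_nf
    have e2 : (1 - u) ^ (a + t - s - 1) = (1 - u) ^ (a - 1) * (1 - u) ^ (t - s) := by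
      rw [← Real.rpow_add_natCast hu1.ne', Nat.cast_sub hs]; ring_nf
    have hB := (beta_pos hα hβ).ne'
    have hB' := (beta_pos ha ha).ne'
    rw [e1, e2, seqProb]
    field_simp
  · rw [if_neg hu, if_neg hu]
    simp

variable {Ω : Type*}

/-- The event that the first `t` observations are those of the sequence `x`. -/
def obsCylinder (X : ℕ → Ω → Bool) (t : ℕ) (x : ℕ → Bool) : Set Ω := {ω | ∀ i < t, X i ω = x i}

theorem successes_eq_of_mem_cylinder {X : ℕ → Ω → Bool} {t : ℕ} {x : ℕ → Bool} {ω : Ω}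
    (hω : ω ∈ obsCylinder X t x) : successes (fun i => X i ω) t = successes x t :=
  successes_congr hω

theorem successes_update_self (x : ℕ → Bool) (t : ℕ) (b : Bool) :
    successes (Function.update x t b) (t + 1) = successes x t + b.toNat := by
  rw [successes_succ, Function.update_self,
    successes_congr fun i hi => Function.update_of_ne (Nat.ne_of_lt hi) b x]

theorem cylinder_succ_update (X : ℕ → Ω → Bool) (t : ℕ) (x : ℕ → Bool) (b : Bool) :
    obsCylinder X (t + 1) (Function.update x t b) = obsCylinder X t x ∩ {ω | X t ω = b} := by
  ext ω
  constructor
  · intro hω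
    refine ⟨fun i hi => ?_, ?_⟩
    · rw [hω i (by omega), Function.update_of_ne hi.ne]
    · have := hω t (Nat.lt_succ_self t)
      rwa [Function.update_self] at this
  · rintro ⟨h1, h2⟩ i hi
    rcases Nat.lt_succ_iff_lt_or_eq.1 hi with hi | rfl
    · rw [h1 i hi, Function.update_of_ne hi.ne]
    · rw [Function.update_self]; exact h2

variable [m : MeasurableSpace Ω]

theorem measurableSet_cylinder {X : ℕ → Ω → Bool} (hX : ∀ i, Measurable (X i)) (t : ℕ)
    (x : ℕ → Bool) : MeasurableSet (obsCylinder X t x) := by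
  have : obsCylinder X t x = ⋂ i, ⋂ (_ : i < t), X i ⁻¹' {x i} := by
    ext ω; simp [obsCylinder]
  rw [this]
  exact MeasurableSet.iInter fun i => MeasurableSet.iInter fun _ => hX i (measurableSet_singleton _)

/-- Every such set is a preimage under the vector of the first `t` observations. Hence stopping
decisions and estimates are constant on cylinders. -/
theorem mem_iff_of_measurableSet_obsFiltration {X : ℕ → Ω → Bool} (hX : ∀ i, Measurable (X i))
    {t : ℕ} {S : Set Ω} (hS : MeasurableSet[obsFiltration X hX t] S) {ω ω' : Ω}
    (hω : ∀ i < t, X i ω = X i ω') : ω ∈ S ↔ ω' ∈ S := by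
  have hle : obsFiltration X hX t ≤
      MeasurableSpace.comap (fun ω (i : Fin t) => X i ω) (⊤ : MeasurableSpace (Fin t → Bool)) := by
    refine iSup_le fun i => ?_
    have : X i = (fun y : Fin t → Bool => y i) ∘ fun ω (i : Fin t) => X i ω := rfl
    rw [this, ← MeasurableSpace.comap_comp]
    exact MeasurableSpace.comap_mono le_top
  obtain ⟨B, -, rfl⟩ := hle S hS
  have : (fun i : Fin t => X i ω) = fun i : Fin t => X i ω' := funext fun i => hω i i.2
  simp only [Set.mem_preimage, this]

theorem measurable_successes_obsFiltration {X : ℕ → Ω → Bool} (hX : ∀ i, Measurable (X i))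
    (t : ℕ) : Measurable[obsFiltration X hX t] fun ω => successes (fun i => X i ω) t := by
  unfold successes
  refine Finset.measurable_fun_sum _ fun i hi => ?_
  have h1 : Measurable[obsFiltration X hX t] (X i) :=
    Measurable.of_comap_le (le_iSup_of_le (⟨i, Finset.mem_range.1 hi⟩ : Fin t) le_rfl)
  exact (measurable_of_countable Bool.toNat).comp h1

variable {μ : Measure Ω} {θ : Ω → ℝ} {X : ℕ → Ω → Bool}

theorem IsBetaBernoulli.measureReal_cylinder_inter (hX : IsBetaBernoulli a μ θ X) (ha : 0 < a)
    (t : ℕ) (x : ℕ → Bool) {B : Set ℝ} (hB : MeasurableSet B) :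
    μ.real (obsCylinder X t x ∩ θ ⁻¹' B) = seqProb a t (successes x t) *
      (betaMeasure (a + successes x t) (a + t - successes x t)).real B := by
  have h1 : obsCylinder X t x ∩ θ ⁻¹' B = {ω | θ ω ∈ B ∧ ∀ i < t, X i ω = x i} := by
    ext ω; exact and_comm
  have hmeas : Measurable fun u : ℝ =>
      ∏ i ∈ Finset.range t, ENNReal.ofReal (if x i then u else 1 - u) := by
    refine Finset.measurable_fun_prod _ fun i _ => ?_
    split_ifs <;> fun_prop
  have hpdf : ∀ α β : ℝ, Measurable (betaPDF α β) := fun α β => by unfold betaPDF; fun_prop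
  have hpos := (seqProb_pos ha (successes_le x t)).le
  rw [measureReal_def, h1, hX.law t x B hB, betaMeasure,
    setLIntegral_withDensity_eq_setLIntegral_mul _ (hpdf a a) hmeas hB]
  simp only [Pi.mul_apply]
  simp_rw [betaPDF_mul_likelihood ha x t]
  rw [lintegral_const_mul _ (hpdf _ _), ENNReal.toReal_mul, ENNReal.toReal_ofReal hpos,
    measureReal_def, betaMeasure, withDensity_apply _ hB]

theorem IsBetaBernoulli.measureReal_cylinder (hX : IsBetaBernoulli a μ θ X) (ha : 0 < a)
    (t : ℕ) (x : ℕ → Bool) : μ.real (obsCylinder X t x) = seqProb a t (successes x t) := by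
  obtain ⟨hα, hβ⟩ := posterior_param_pos ha (successes_le x t)
  have := isProbabilityMeasureBeta hα hβ
  have h := hX.measureReal_cylinder_inter ha t x MeasurableSet.univ
  simpa using h

end Cylinder

/-! ### Dynamic programming over cylinders. -/

section Procedure

variable {a h c : ℝ} {Ω : Type*} [m : MeasurableSpace Ω] {μ : Measure Ω} {θ : Ω → ℝ}
  {X : ℕ → Ω → Bool} {T : Ω → ℕ} {est : ℕ → Ω → ℝ} {H : ℕ}

/-- The contribution of the event `A` to the residual cost after time `t`. -/
noncomputable def costOn (μ : Measure Ω) (θ : Ω → ℝ) (h c : ℝ) (T : Ω → ℕ) (est : ℕ → Ω → ℝ)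
    (t : ℕ) (A : Set Ω) : ℝ :=
  c * (∫ ω in A, ((T ω : ℝ) - t) ∂μ) + μ.real (A ∩ {ω | h < |est (T ω) ω - θ ω|})

theorem costOn_step [IsProbabilityMeasure μ] (hX : IsBetaBernoulli a μ θ X)
    (hT : Integrable (fun ω => (T ω : ℝ)) μ) (t : ℕ) (x : ℕ → Bool) :
    costOn μ θ h c T est t (obsCylinder X t x) =
      c * μ.real (obsCylinder X t x) +
        (costOn μ θ h c T est (t + 1) (obsCylinder X (t + 1) (Function.update x t true)) +
          costOn μ θ h c T est (t + 1) (obsCylinder X (t + 1) (Function.update x t false))) := by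
  set A := obsCylinder X t x
  have hB : MeasurableSet {ω | X t ω = true} := hX.measurable_obs t (measurableSet_singleton true)
  have h1 : obsCylinder X (t + 1) (Function.update x t true) = A ∩ {ω | X t ω = true} :=
    cylinder_succ_update X t x true
  have h0 : obsCylinder X (t + 1) (Function.update x t false) = A \ {ω | X t ω = true} := by
    rw [cylinder_succ_update X t x false]
    ext ω; simp [A]
  have hint : ∀ r : ℝ, IntegrableOn (fun ω => (T ω : ℝ) - r) A μ := fun r =>
    (hT.sub (integrable_const r)).integrableOn
  have e1 : ∫ ω in A, ((T ω : ℝ) - t) ∂μ = μ.real A + ∫ ω in A, ((T ω : ℝ) - (t + 1 : ℕ)) ∂μ := by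
    have : ∀ ω, (T ω : ℝ) - t = 1 + ((T ω : ℝ) - (t + 1 : ℕ)) := fun ω => by push_cast; ring
    simp_rw [this]
    rw [integral_add (integrable_const 1) (hint _)]
    simp
  set E := {ω | h < |est (T ω) ω - θ ω|}
  -- Only the splitting set needs to be measurable here, not the error event `E`.
  have e2 : μ.real (A ∩ E) = μ.real (A ∩ {ω | X t ω = true} ∩ E) +
      μ.real ((A \ {ω | X t ω = true}) ∩ E) := by
    rw [← measureReal_inter_add_sdiff (μ := μ) (s := A ∩ E) hB, Set.inter_right_comm,
      Set.inter_sdiff_right_comm]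
  rw [costOn, costOn, costOn, h1, h0, e1, e2, ← integral_inter_add_sdiff hB (hint (t + 1 : ℕ))]
  ring

theorem costOn_of_time_eq (hX : IsBetaBernoulli a μ θ X) (ha : 0 < a) {t : ℕ} {x : ℕ → Bool} {p : ℝ}
    (hT : ∀ ω ∈ obsCylinder X t x, T ω = t) (hest : ∀ ω ∈ obsCylinder X t x, est t ω = p) :
    costOn μ θ h c T est t (obsCylinder X t x) = seqProb a t (successes x t) *
      (betaMeasure (a + successes x t) (a + t - successes x t)).real {u | h < |p - u|} := by
  have hA := measurableSet_cylinder hX.measurable_obs t x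
  have e1 : ∫ ω in obsCylinder X t x, ((T ω : ℝ) - t) ∂μ = 0 := by
    rw [setIntegral_congr_fun hA (g := fun _ => 0) fun ω hω => by simp [hT ω hω]]
    simp
  have e2 : obsCylinder X t x ∩ {ω | h < |est (T ω) ω - θ ω|} =
      obsCylinder X t x ∩ θ ⁻¹' {u | h < |p - u|} := by
    ext ω
    refine and_congr_right fun hω => ?_
    simp [hT ω hω, hest ω hω]
  rw [costOn, e1, e2, mul_zero, zero_add]
  exact hX.measureReal_cylinder_inter ha t x (measurableSet_lt measurable_const (by fun_prop))

theorem seqProb_mul_continuation (ha : 0 < a) (k : ℕ) {t s : ℕ} (hs : s ≤ t) :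
    seqProb a t s * (c + (predProb a t s * residualCost a h c k (t + 1) (s + 1)
        + (1 - predProb a t s) * residualCost a h c k (t + 1) s)) =
      c * seqProb a t s + (seqProb a (t + 1) (s + 1) * residualCost a h c k (t + 1) (s + 1) +
        seqProb a (t + 1) s * residualCost a h c k (t + 1) s) := by
  rw [seqProb_succ_succ ha hs, seqProb_succ ha hs]
  ring

theorem IsProcedure.integrable_time [IsProbabilityMeasure μ] {hX : ∀ i, Measurable (X i)}
    (hP : IsProcedure X hX H T est) : Integrable (fun ω => (T ω : ℝ)) μ := by
  have hT : Measurable T := measurable_of_Iic fun i => by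
    have hset : T ⁻¹' Set.Iic i = {ω | (T ω : WithTop ℕ) ≤ i} := by ext ω; simp
    rw [hset]
    exact (obsFiltration X hX).le i _ (hP.stopping i)
  refine Integrable.of_bound ((measurable_of_countable _).comp hT).aestronglyMeasurable (H : ℝ)
    (Filter.Eventually.of_forall fun ω => ?_)
  simpa using hP.le_horizon ω

theorem IsProcedure.time_eq_of_mem_cylinder {hX : ∀ i, Measurable (X i)}
    (hP : IsProcedure X hX H T est) {t : ℕ} {x : ℕ → Bool} {ω ω' : Ω}
    (hω : ω ∈ obsCylinder X t x) (hω' : ω' ∈ obsCylinder X t x)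
    (hle : t ≤ T ω') (heq : T ω = t) : T ω' = t := by
  have h1 := (mem_iff_of_measurableSet_obsFiltration hX (hP.stopping t)
    fun i hi => (hω i hi).trans (hω' i hi).symm).1 (by simp [heq])
  exact le_antisymm (by simpa using h1) hle

theorem IsProcedure.est_eq_of_mem_cylinder {hX : ∀ i, Measurable (X i)}
    (hP : IsProcedure X hX H T est) {t : ℕ} {x : ℕ → Bool} {ω ω' : Ω}
    (hω : ω ∈ obsCylinder X t x) (hω' : ω' ∈ obsCylinder X t x) : est t ω' = est t ω :=
  (mem_iff_of_measurableSet_obsFiltration hX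
    (hP.measurable_est t (measurableSet_singleton (est t ω)))
    fun i hi => (hω i hi).trans (hω' i hi).symm).1 rfl

/-- On a cylinder of length `t` not stopped earlier, the decision at `t` is common to all points.
Stopping costs at least the first term of the minimum; continuing splits the cylinder in two and, by
induction, costs at least the second. -/
theorem IsProcedure.residualCost_le_costOn [IsProbabilityMeasure μ] (ha : 0 < a)
    (hX : IsBetaBernoulli a μ θ X) (hP : IsProcedure X hX.measurable_obs H T est) (k : ℕ) {t : ℕ}
    (htk : t + k = H) {x : ℕ → Bool} (hle : ∀ ω ∈ obsCylinder X t x, t ≤ T ω) :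
    seqProb a t (successes x t) * residualCost a h c k t (successes x t) ≤
      costOn μ θ h c T est t (obsCylinder X t x) := by
  induction k generalizing t x with
  | zero =>
    have hs := successes_le x t
    have hw := hX.measureReal_cylinder ha t x
    rw [add_zero] at htk
    -- A point of the cylinder is needed to read off the constant estimate; positive probability
    -- excludes the empty case.
    rcases (obsCylinder X t x).eq_empty_or_nonempty with hA | ⟨ω₀, hω₀⟩
    · rw [hA, measureReal_empty] at hw
      exact absurd hw (seqProb_pos ha hs).ne
    · rw [costOn_of_time_eq hX ha (p := est t ω₀)
        (fun ω hω => le_antisymm (htk ▸ hP.le_horizon ω) (hle ω hω))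
        (fun ω hω => hP.est_eq_of_mem_cylinder hω₀ hω)]
      exact mul_le_mul_of_nonneg_left (missProb_le a h t _ _) (seqProb_pos ha hs).le
  | succ k ih =>
    have hs := successes_le x t
    by_cases hhalt : ∃ ω₀ ∈ obsCylinder X t x, T ω₀ = t
    · obtain ⟨ω₀, hω₀, hT₀⟩ := hhalt
      rw [costOn_of_time_eq hX ha (p := est t ω₀)
        (fun ω hω => hP.time_eq_of_mem_cylinder hω₀ hω (hle ω hω) hT₀)
        (fun ω hω => hP.est_eq_of_mem_cylinder hω₀ hω)]
      exact mul_le_mul_of_nonneg_left ((residualCost_le_missProb a h c _ t _).trans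
        (missProb_le a h t _ _)) (seqProb_pos ha hs).le
    · push Not at hhalt
      have hle' : ∀ b, ∀ ω ∈ obsCylinder X (t + 1) (Function.update x t b), t + 1 ≤ T ω := by
        intro b ω hω
        rw [cylinder_succ_update] at hω
        exact Nat.lt_of_le_of_ne (hle ω hω.1) (hhalt ω hω.1).symm
      have h1 := ih (by omega) (hle' true)
      have h0 := ih (by omega) (hle' false)
      rw [successes_update_self] at h1 h0
      rw [costOn_step hX hP.integrable_time, hX.measureReal_cylinder ha]
      refine (mul_le_mul_of_nonneg_left (min_le_right _ _) (seqProb_pos ha hs).le).trans ?_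
      rw [seqProb_mul_continuation ha k hs]
      simp only [Bool.toNat_true, Bool.toNat_false, add_zero] at h1 h0
      linarith

theorem costOn_zero_eq_seqCost (x : ℕ → Bool) :
    costOn μ θ h c T est 0 (obsCylinder X 0 x) = seqCost μ θ h c T est := by
  have : obsCylinder X 0 x = Set.univ := by ext ω; simp [obsCylinder]
  rw [costOn, seqCost, this]
  simp

theorem optTime_eq_of_mem_cylinder {Ω : Type*} {X : ℕ → Ω → Bool} {t : ℕ} {x : ℕ → Bool} (htH : t ≤ H)
    (heq : residualCost a h c (H - t) t (successes x t) = missProb a h t (successes x t)) {ω : Ω}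
    (hω : ω ∈ obsCylinder X t x) (hle : t ≤ optTime a h c H fun i => X i ω) :
    optTime a h c H (fun i => X i ω) = t := by
  refine le_antisymm (optTime_le htH ?_) hle
  rwa [successes_eq_of_mem_cylinder hω]

/-- The same induction with each inequality attained: `optTime` stops exactly when the minimum
equals its first term, and `mid` attains the infimum in `missProb`. -/
theorem costOn_optTime_le [IsProbabilityMeasure μ] (ha : 0 < a)
    (hX : IsBetaBernoulli a μ θ X) {mid : ℕ → ℕ → ℝ}
    (hmid : ∀ t s : ℕ, s ≤ t →
      (betaMeasure (a + s) (a + t - s)).real {u | h < |mid t s - u|} = missProb a h t s)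
    (hint : Integrable (fun ω => ((optTime a h c H fun i => X i ω : ℕ) : ℝ)) μ) (k : ℕ) {t : ℕ}
    (htk : t + k = H) {x : ℕ → Bool}
    (hle : ∀ ω ∈ obsCylinder X t x, t ≤ optTime a h c H fun i => X i ω) :
    costOn μ θ h c (fun ω => optTime a h c H fun i => X i ω)
        (fun t ω => mid t (successes (fun i => X i ω) t)) t (obsCylinder X t x) ≤
      seqProb a t (successes x t) * residualCost a h c k t (successes x t) := by
  induction k generalizing t x with
  | zero =>
    have hk : H - t = 0 := by omega
    rw [costOn_of_time_eq hX ha (p := mid t (successes x t))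
      (fun ω hω => optTime_eq_of_mem_cylinder (by omega) (by rw [hk]; rfl) hω (hle ω hω))
      (fun ω hω => by rw [successes_eq_of_mem_cylinder hω]), hmid t _ (successes_le x t)]
    exact le_rfl
  | succ k ih =>
    have hs := successes_le x t
    have hk : H - t = k + 1 := by omega
    by_cases hhalt : residualCost a h c (k + 1) t (successes x t) = missProb a h t (successes x t)
    · rw [costOn_of_time_eq hX ha (p := mid t (successes x t))
        (fun ω hω => optTime_eq_of_mem_cylinder (by omega) (by rw [hk]; exact hhalt) hω (hle ω hω))
        (fun ω hω => by rw [successes_eq_of_mem_cylinder hω]), hmid t _ hs, hhalt]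
    · have hle' : ∀ b, ∀ ω ∈ obsCylinder X (t + 1) (Function.update x t b),
          t + 1 ≤ optTime a h c H fun i => X i ω := by
        intro b ω hω
        rw [cylinder_succ_update] at hω
        refine Nat.lt_of_le_of_ne (hle ω hω.1) fun heq => hhalt ?_
        have hspec := (optTime_spec a h c H fun i => X i ω).2
        rwa [← heq, successes_eq_of_mem_cylinder hω.1, hk] at hspec
      have h1 := ih (by omega) (hle' true)
      have h0 := ih (by omega) (hle' false)
      rw [successes_update_self] at h1 h0
      have hval : residualCost a h c (k + 1) t (successes x t) = c +
          (predProb a t (successes x t) * residualCost a h c k (t + 1) (successes x t + 1) +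
            (1 - predProb a t (successes x t)) * residualCost a h c k (t + 1) (successes x t)) :=
        (min_choice _ _).resolve_left hhalt
      rw [costOn_step hX hint, hX.measureReal_cylinder ha, hval, seqProb_mul_continuation ha k hs]
      simp only [Bool.toNat_true, Bool.toNat_false, add_zero] at h1 h0
      linarith

theorem isStoppingTime_optTime (a h c : ℝ) (H : ℕ) (hX : ∀ i, Measurable (X i)) :
    IsStoppingTime (obsFiltration X hX)
      (fun ω => ((optTime a h c H fun i => X i ω : ℕ) : WithTop ℕ)) := by
  intro j
  have hset : {ω | ((optTime a h c H fun i => X i ω : ℕ) : WithTop ℕ) ≤ j} =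
      ⋃ t, ⋃ (_ : t ≤ j ∧ t ≤ H), (fun ω => successes (fun i => X i ω) t) ⁻¹'
        {s | residualCost a h c (H - t) t s = missProb a h t s} := by
    ext ω
    simp only [Set.mem_ofPred_eq, Nat.cast_le, Set.mem_iUnion, Set.mem_preimage]
    constructor
    · intro hle
      have hspec := optTime_spec a h c H fun i => X i ω
      exact ⟨_, ⟨hle, hspec.1⟩, hspec.2⟩
    · rintro ⟨t, ⟨htj, htH⟩, heq⟩
      exact (optTime_le htH heq).trans htj
  refine (congrArg (MeasurableSet[obsFiltration X hX j]) hset).mpr ?_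
  refine MeasurableSet.iUnion fun t => MeasurableSet.iUnion fun ht => ?_
  exact (obsFiltration X hX).mono ht.1 _
    (measurable_successes_obsFiltration hX t (MeasurableSet.of_discrete))

theorem exists_isOptimalProcedure_optTime [IsProbabilityMeasure μ] (ha : 0 < a)
    (hX : IsBetaBernoulli a μ θ X) (h c : ℝ) (H : ℕ) :
    ∃ est : ℕ → Ω → ℝ, IsOptimalProcedure μ θ X hX.measurable_obs h c H
      (fun ω => optTime a h c H (fun i => X i ω)) est := by
  have hex : ∀ t s : ℕ, ∃ p : ℝ, s ≤ t →
      (betaMeasure (a + s) (a + t - s)).real {u | h < |p - u|} = missProb a h t s := by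
    intro t s
    by_cases hs : s ≤ t
    · obtain ⟨p, hp⟩ := exists_missProb_eq ha h hs
      exact ⟨p, fun _ => hp⟩
    · exact ⟨0, fun h => absurd h hs⟩
  choose mid hmid using hex
  have hP : IsProcedure X hX.measurable_obs H (fun ω => optTime a h c H (fun i => X i ω))
      (fun t ω => mid t (successes (fun i => X i ω) t)) :=
    { stopping := isStoppingTime_optTime a h c H hX.measurable_obs
      le_horizon := fun ω => (optTime_spec a h c H _).1
      measurable_est := fun t => (measurable_of_countable (mid t)).comp
        (measurable_successes_obsFiltration hX.measurable_obs t) }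
  refine ⟨_, hP, fun T' est' hP' => ?_⟩
  rw [← costOn_zero_eq_seqCost (X := X) (fun _ => true),
    ← costOn_zero_eq_seqCost (X := X) (fun _ => true)]
  exact (costOn_optTime_le ha hX hmid hP.integrable_time H (zero_add H)
    fun _ _ => Nat.zero_le _).trans
    (hP'.residualCost_le_costOn ha hX H (zero_add H) fun _ _ => Nat.zero_le _)

end Procedure

/-! ### Assembly of the main theorem. -/

theorem theorem2 (a h : ℝ) (ha : 0 < a) (hh : 0 < h) (hh' : h < 1 / 2) :
    -- `T_o` solves the unconstrained problem, for every cost and every horizon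
    (∀ (Ω : Type*) [MeasurableSpace Ω] (μ : Measure Ω) [IsProbabilityMeasure μ]
        (θ : Ω → ℝ) (X : ℕ → Ω → Bool) (hX : IsBetaBernoulli a μ θ X) (c : ℝ) (H : ℕ), 0 < c →
      ∃ est : ℕ → Ω → ℝ, IsOptimalProcedure μ θ X hX.measurable_obs h c H
        (fun ω => optTime a h c H (fun i => X i ω)) est) ∧
    -- `T_o` never exceeds the explicit bound `N`, which does not depend on the horizon
    (∀ c : ℝ, 0 < c → ∀ (H : ℕ) (x : ℕ → Bool), optTime a h c H x ≤ upperTime a h c) ∧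
    -- the explicit lower bound `ν`, under the explicit smallness condition `c (N + 1) ≤ 𝒞_0`
    (∀ c : ℝ, 0 < c → c * (upperTime a h c + 1) ≤ missProb a h 0 0 →
      ∀ H : ℕ, upperTime a h c ≤ H → ∀ x : ℕ → Bool, lowerTime a h c ≤ optTime a h c H x) ∧
    -- the condition holds and the bound `ν` is nontrivial for all small `c`
    (∃ c₀ : ℝ, 0 < c₀ ∧ ∀ c : ℝ, 0 < c → c ≤ c₀ →
      c * (upperTime a h c + 1) ≤ missProb a h 0 0 ∧ 1 ≤ lowerTime a h c) ∧
    -- logarithmic bounds with constants depending only on `a` and `h`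
    (∃ C₀ C₁ : ℝ, 0 < C₀ ∧ C₀ < C₁ ∧
      (∀ c : ℝ, 0 < c → ∀ (H : ℕ) (x : ℕ → Bool),
        (optTime a h c H x : ℝ) ≤ C₁ * |Real.log c|) ∧
      (∃ c₀ : ℝ, 0 < c₀ ∧ ∀ c : ℝ, 0 < c → c ≤ c₀ → ∀ H : ℕ, upperTime a h c ≤ H →
        ∀ x : ℕ → Bool, C₀ * |Real.log c| ≤ (optTime a h c H x : ℝ))) := by
  have hlq : Real.log (1 / 2 - h) < 0 := Real.log_neg (by linarith) (by linarith)
  have hrate : 0 < 1 / (2 * |Real.log (1 / 2 - h)|) := by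
    have := abs_pos.2 hlq.ne
    positivity
  obtain ⟨c₀, hc₀, hsmall⟩ := exists_forall_small_cost ha hh hh'
  refine ⟨?_, fun c hc H x => optTime_le_upperTime ha hh hc H x,
    fun c hc hcond H hH x => lowerTime_le_optTime ha hh hh' hc hcond hH x, ⟨c₀, hc₀, ?_⟩, ?_⟩
  · intro Ω _ μ _ θ X hX c H _
    exact exists_isOptimalProcedure_optTime ha hX h c H
  · intro c hc hcle
    obtain ⟨hlog, hcond, hlow⟩ := hsmall c hc hcle
    refine ⟨hcond, ?_⟩
    have : (0 : ℝ) < lowerTime a h c := (mul_pos hrate hlog).trans_le hlow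
    exact_mod_cast this
  -- `C₀` is the half rate `1 / (2 |log (1/2 - h)|)`; using it as `B` yields `C₀ < C₁`.
  · obtain ⟨C₁, hC₁, hupper⟩ :=
      exists_optTime_le_mul_abs_log ha hh hh' (1 / (2 * |Real.log (1 / 2 - h)|))
    refine ⟨_, C₁, hrate, hC₁, hupper, c₀, hc₀, fun c hc hcle H hH x => ?_⟩
    obtain ⟨-, hcond, hlow⟩ := hsmall c hc hcle
    refine hlow.trans ?_
    exact_mod_cast lowerTime_le_optTime ha hh hh' hc hcond hH x
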